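/- For $\pi\in\mathfrak S_n$ let $\operatorname{occ}_{12\cdots m}(\pi)$ be the number of indices $i$ with $1\le i\le n-m+1$ and $\pi_i<\pi_{i+1}<\cdots<\pi_{i+m-1}$, and let $\operatorname{ipk}(\pi)$ be the number of peaks of $\pi^{-1}$, i.e. the number of $i\in\{2,\dots,n-1\}$ with $\pi^{-1}_{i-1}<\pi^{-1}_i>\pi^{-1}_{i+1}$. For $n\ge 1$ put $$P^{\operatorname{ipk}}_{12\cdots m,n}(s,t)=\sum_{\pi\in\mathfrak S_n}s^{\operatorname{occ}_{12\cdots m}(\pi)}t^{\operatorname{ipk}(\pi)+1},\qquad P^{\operatorname{ipk}}_{12\cdots m,n}(t)=P^{\operatorname{ipk}}_{12\cdots m,n}(0,t).$$ For formal power series in $t$ with coefficients in the ring $\mathbb Q[s][[x]]$, let $f^{*\langle n\rangle}$ be the $n$-fold Hadamard product of $f$ in $t$, so that $\big(\sum_{k\ge0} a_kt^k\big)^{*\langle n\rangle}=\sum_{k\ge0} a_k^n t^k$ and in particular $f^{*\langle 0\rangle}=1/(1-t)$. All other products and inverses are the ordinary ones. **Theorem 4.5.** Let $m\ge 2$, $u=\dfrac{4t}{(1+t)^2}$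 and $z=\dfrac{(1+t)x}{1-t}$. Then the following identities hold in $\mathbb Q[s][[x]][[t]]$, where all denominators are invertible and all infinite sums converge as formal power series. (a) $$\frac1{1-t}+\frac{1+t}{2(1-t)}\sum_{n=1}^\infty P^{\operatorname{ipk}}_{12\cdots m,n}(s,u)z^n=\sum_{n=0}^\infty\left(\frac{2tx}{(1-t)^2}+\frac{2t(s-1)z^m}{(1-t^2)\left(1-(s-1)\sum_{l=1}^{m-1}z^l\right)}\right)^{*\langle n\rangle}$$ (b) $$\frac1{1-t}+\frac{1+t}{2(1-t)}\sum_{n=1}^\infty P^{\operatorname{ipk}}_{12\cdots m,n}(u)z^n=\sum_{n=0}^\infty\left(\frac{2tz(1-z^{m-1})}{(1-t^2)(1-z^m)}\right)^{*\langle n\rangle}$$ (c) $$\frac1{1-t}+\frac{1+t}{2(1-t)}\sum_{n=1}^\infty P^{\operatorname{ipk}}_{12\cdots m,n}(u)z^n=1+\sum_{k=1}^\infty\left[1-2kx+\sum_{j=1}^\infty\left(c_{m,j,k}x^{jm}-c'_{m,j,k}x^{jm+1}\right)\right]^{-1}t^k,$$ where $$c_{m,j,k}=2\sum_{l=1}^k\binom{l+jm-1}{l-1}\binom{jm-1}{k-l},\qquad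 c'_{m,j,k}=2\sum_{l=1}^k\binom{l+jm}{l-1}\binom{jm}{k-l}.$$ -/

import Mathlib

open scoped Polynomial PowerSeries PowerSeries.WithPiTopology

namespace MonotoneIpk

section Permutations

variable {m n : ℕ}

/-- `σ` occurs in `π` as a consecutive pattern at position `i` (counted from `0`): the factor
`π i, …, π (i + m - 1)` fits into `π` and is order-isomorphic to `σ`. -/
def OccursAt (σ : Equiv.Perm (Fin m)) (π : Equiv.Perm (Fin n)) (i : ℕ) : Prop :=
  ∃ h : i + m ≤ n, ∀ a b : Fin m,
    π ⟨i + a, by omega⟩ < π ⟨i + b, by omega⟩ ↔ σ a < σ b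

open Classical in
/-- The number of occurrences of `σ` in `π` as a consecutive pattern. -/
noncomputable def occ (σ : Equiv.Perm (Fin m)) (π : Equiv.Perm (Fin n)) : ℕ :=
  ((Finset.range (n + 1)).filter fun i => OccursAt σ π i).card

/-- `π` has a peak with neighbouring positions `i`, `i + 1`, `i + 2` (counted from `0`), that is
`π i < π (i + 1) > π (i + 2)`. -/
def PeakAt (π : Equiv.Perm (Fin n)) (i : ℕ) : Prop :=
  ∃ h : i + 2 < n,
    π ⟨i, by omega⟩ < π ⟨i + 1, by omega⟩ ∧ π ⟨i + 2, h⟩ < π ⟨i + 1, by omega⟩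

open Classical in
/-- The peak number. -/
noncomputable def pk (π : Equiv.Perm (Fin n)) : ℕ :=
  ((Finset.range n).filter fun i => PeakAt π i).card

/-- The inverse peak number. -/
noncomputable def ipk (π : Equiv.Perm (Fin n)) : ℕ := pk π⁻¹

/-- The value at `(a, b)` of the bivariate polynomial `P^{ipk}_{σ,n}(s,t)`, which is
`∑_π s^{occ_σ(π)} t^{ipk(π)+1}` over all permutations `π` of length `n` if `n ≥ 1`, and `1` if
`n = 0`. The value at `a = 0` is that of `P^{ipk}_{σ,n}(t)`. -/
noncomputable def ipkPoly {R : Type*} [CommRing R] (σ : Equiv.Perm (Fin m)) (n : ℕ) (a b : R) :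
    R :=
  if n = 0 then 1 else ∑ π : Equiv.Perm (Fin n), a ^ occ σ π * b ^ (ipk π + 1)

/-- The monotone pattern `12⋯m`. -/
def mono (m : ℕ) : Equiv.Perm (Fin m) := 1

end Permutations

section Hadamard

variable {B : Type*} [CommRing B]

/-- The Hadamard product (in the variable of the power series, with the usual multiplication of
coefficients). -/
noncomputable def hadamard (f g : B⟦X⟧) : B⟦X⟧ :=
  PowerSeries.mk fun k => PowerSeries.coeff k f * PowerSeries.coeff k g

/-- The `n`-fold Hadamard product of `f`; for `n = 0` this is the identity `∑ t^k = 1/(1-t)` of the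
Hadamard product. -/
noncomputable def hadamardPow (f : B⟦X⟧) : ℕ → B⟦X⟧
  | 0 => PowerSeries.mk fun _ => 1
  | n + 1 => hadamard (hadamardPow f n) f

end Hadamard

/-- The polynomial ring `ℚ[s]` is discrete, so that `ℚ[s]⟦x⟧` and `ℚ[s]⟦x⟧⟦t⟧` carry the usual
topology of formal power series, in which a sum converges if and only if each coefficient of it
has only finitely many nonzero terms. -/
instance : TopologicalSpace ℚ[X] := ⊥

instance : DiscreteTopology ℚ[X] := ⟨rfl⟩

/-- Formal power series in `x` with coefficients in `ℚ[s]`. -/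
abbrev SX : Type := ℚ[X]⟦X⟧

/-- Formal power series in `x` and `t` with coefficients in `ℚ[s]`; the outer variable is `t`, so
`hadamard` on this ring is the Hadamard product in `t`. -/
abbrev SXT : Type := SX⟦X⟧

/-- The variable `s`. -/
noncomputable def s : SXT := PowerSeries.C (PowerSeries.C Polynomial.X)

/-- The variable `x` in `ℚ[s]⟦x⟧`. -/
noncomputable def x₀ : SX := PowerSeries.X

/-- The variable `x`. -/
noncomputable def x : SXT := PowerSeries.C x₀

/-- The variable `t`. -/
noncomputable def t : SXT := PowerSeries.X

/-- `u = 4t/(1+t)^2`. -/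
noncomputable def u : SXT := 4 * t * Ring.inverse ((1 + t) ^ 2)

/-- `z = (1+t)x/(1-t)`. -/
noncomputable def z : SXT := (1 + t) * x * Ring.inverse (1 - t)

/-- `1/(1-t) + (1+t)/(2(1-t)) ∑_{n ≥ 1} P^{ipk}_{12⋯m,n}(a,u) z^n`. -/
noncomputable def genFun (m : ℕ) (a : SXT) : SXT :=
  Ring.inverse (1 - t) + (1 + t) * Ring.inverse (2 * (1 - t)) *
    ∑' n : ℕ, ipkPoly (mono m) (n + 1) a u * z ^ (n + 1)

/-- `2tx/(1-t)^2 + 2t(s-1)z^m / ((1-t^2)(1-(s-1)∑_{l=1}^{m-1} z^l))`. -/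
noncomputable def termA (m : ℕ) : SXT :=
  2 * t * x * Ring.inverse ((1 - t) ^ 2) +
    2 * t * (s - 1) * z ^ m *
      Ring.inverse ((1 - t ^ 2) * (1 - (s - 1) * ∑ l ∈ Finset.Icc 1 (m - 1), z ^ l))

/-- `2tz(1-z^{m-1}) / ((1-t^2)(1-z^m))`. -/
noncomputable def termB (m : ℕ) : SXT :=
  2 * t * z * (1 - z ^ (m - 1)) * Ring.inverse ((1 - t ^ 2) * (1 - z ^ m))

/-- `c_{m,j,k}`, used for `j ≥ 1` and `k ≥ 1`. -/
def c (m j k : ℕ) : ℕ :=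
  2 * ∑ l ∈ Finset.Icc 1 k, (l + j * m - 1).choose (l - 1) * (j * m - 1).choose (k - l)

/-- `c'_{m,j,k}`, used for `j ≥ 1` and `k ≥ 1`. -/
def c' (m j k : ℕ) : ℕ :=
  2 * ∑ l ∈ Finset.Icc 1 k, (l + j * m).choose (l - 1) * (j * m).choose (k - l)

/-- The summand `c_{m,j,k} x^{jm} - c'_{m,j,k} x^{jm+1}`. -/
noncomputable def summandC (m k j : ℕ) : SX :=
  (c m j k : SX) * x₀ ^ (j * m) - (c' m j k : SX) * x₀ ^ (j * m + 1)

/-- `1 - 2kx + ∑_{j ≥ 1} (c_{m,j,k} x^{jm} - c'_{m,j,k} x^{jm+1})`. -/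
noncomputable def denomC (m k : ℕ) : SX :=
  1 - 2 * (k : SX) * x₀ + ∑' j : ℕ, summandC m k (j + 1)

end MonotoneIpk

/-! All identities are compared coefficientwise in `t`: the coefficient of `t^k` on the left turns
out to count words in the `2k` letters ±1, …, ±k.

Sort the positions of a word by letter, with equal positive letters read from left to right and
equal negative letters from right to left. This standardizes the word to a permutation `π` with the
same ascents, hence the same number of occurrences of 12⋯m. The words with standardization `π`, read
in the order given by `π⁻¹`, are the weakly increasing sequences in which positive letters repeat
only at ascents of `π⁻¹` and negative ones only at descents. A transfer argument on the last letter
(`two_mul_enrichedSeries`) shows that the number of these has generating function `A^(n+1) u^(ipk π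
+ 1) / 2` in `t`, where `n` is the length and `A = (1+t)/(1-t)`. As `z = A x`, the left side
collects all words by length and occurrences (`coeff_genFun`).

Words are then counted by maximal ascending runs (`mk_wordSum_mul_eq_one`): a run of length `r` has
weight `a^(r+1-m)` with truncated exponent, and if `V` is the reciprocal of the series of these
weights, the word series is the reciprocal of `∑ V_l e_l x^l`, where `e_l` counts ascending words of
length `l`. These have generating function `2t(1+t)^(l-1)/(1-t)^(l+1)` for `l ≥ 1`, so that `∑ V_l
e_l x^l` becomes `1/(1-t)` minus the bracket in (a) or (b) (`exists_runSeries_inverse`). A sum of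
Hadamard powers is a geometric series in each coefficient, which gives (a) and, for `a = 0`, (b).
Expanding `V = (1-y)/(1-y^m)` and extracting `e_l` by the binomial theorem gives (c). -/

namespace MonotoneIpk

/-! ### Enriched sequences and the recursion on the last letter -/

section EnrichedCount

/-- The number of enriched sequences of length `n + 1` with last letter `b` (see `IsEnriched`). -/
noncomputable def enrichedCount (P : ℕ → Prop) : ℕ → ℕ → ℕ
  | 0, _ => 1
  | n + 1, b => ∑ b' ∈ Finset.range b, enrichedCount P n b' +
      open Classical in if Odd b ↔ P n then enrichedCount P n b else 0

/-- A sequence of letters is enriched with respect to the set `P` of ascents if it is weakly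
increasing, odd letters being repeated only at elements of `P` and even letters only at
nonelements of `P`. Here the letters `0, 1, 2, 3, …` stand for `-1, 1, -2, 2, …`. -/
def IsEnriched {K n : ℕ} (P : ℕ → Prop) (f : Fin n → Fin K) : Prop :=
  ∀ i, ∀ h : i + 1 < n, f ⟨i, by omega⟩ < f ⟨i + 1, h⟩ ∨
    f ⟨i, by omega⟩ = f ⟨i + 1, h⟩ ∧ (Odd (f ⟨i, by omega⟩ : ℕ) ↔ P i)

open Classical in
/-- The number of enriched sequences of length `n` in `K` letters. -/
noncomputable def enrichedCard (P : ℕ → Prop) (n K : ℕ) : ℕ :=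
  (Finset.univ.filter fun f : Fin n → Fin K => IsEnriched P f).card

theorem isEnriched_snoc {K n : ℕ} (P : ℕ → Prop) (f : Fin (n + 1) → Fin K) (b : Fin K) :
    IsEnriched P (Fin.snoc f b : Fin (n + 2) → Fin K) ↔ IsEnriched P f ∧
      (f (Fin.last n) < b ∨ f (Fin.last n) = b ∧ (Odd (b : ℕ) ↔ P n)) := by
  have hc : ∀ i (h : i < n + 1), (Fin.snoc f b : Fin (n + 2) → Fin K) ⟨i, by omega⟩ = f ⟨i, h⟩ :=
    fun i h => Fin.snoc_castSucc (α := fun _ => Fin K) b f ⟨i, h⟩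
  have hl : (Fin.snoc f b : Fin (n + 2) → Fin K) ⟨n + 1, by omega⟩ = b :=
    Fin.snoc_last (α := fun _ => Fin K) b f
  have key : (f (Fin.last n) < b ∨ f (Fin.last n) = b ∧ (Odd (f (Fin.last n) : ℕ) ↔ P n)) ↔
      (f (Fin.last n) < b ∨ f (Fin.last n) = b ∧ (Odd (b : ℕ) ↔ P n)) := by
    refine or_congr_right (and_congr_right fun h => by rw [h])
  rw [← key]
  constructor
  · intro H
    refine ⟨fun i h => ?_, ?_⟩
    · have := H i (by omega)
      rwa [hc i (by omega), hc (i + 1) h] at this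
    · have := H n (by omega)
      rwa [hc n (by omega), hl] at this
  · rintro ⟨H, H'⟩ i h
    rcases Nat.lt_or_ge i n with hi | hi
    · rw [hc i (by omega), hc (i + 1) (by omega)]
      exact H i (by omega)
    · obtain rfl : i = n := by omega
      rw [hc i (by omega), hl]
      exact H'

open Classical in
theorem sum_last_isEnriched (P : ℕ → Prop) (K n : ℕ) (b : Fin K) :
    ∑ f : Fin (n + 1) → Fin K, (if IsEnriched P f ∧ f (Fin.last n) = b then 1 else 0) =
      enrichedCount P n b := by
  induction n generalizing b with
  | zero =>
    rw [Finset.sum_eq_single (fun _ => b)]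
    · simp [enrichedCount, IsEnriched]
    · intro f _ hf
      rw [if_neg]
      rintro ⟨-, h⟩
      exact hf (funext fun i => by
        rw [← h]
        exact congrArg f (Fin.ext (by simp)))
    · simp
  | succ n ih =>
    rw [← (Fin.snocEquiv fun _ : Fin (n + 2) => Fin K).sum_comp, Fintype.sum_prod_type,
      Finset.sum_eq_single b]
    · have h1 : ∀ f : Fin (n + 1) → Fin K,
          (if IsEnriched P (Fin.snocEquiv (fun _ : Fin (n + 2) => Fin K) (b, f)) ∧
            Fin.snocEquiv (fun _ : Fin (n + 2) => Fin K) (b, f) (Fin.last (n + 1)) = b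
            then 1 else 0) =
          ∑ b' : Fin K, if (b' < b ∨ b' = b ∧ (Odd (b : ℕ) ↔ P n)) then
            (if IsEnriched P f ∧ f (Fin.last n) = b' then 1 else 0) else 0 := by
        intro f
        rw [Finset.sum_eq_single (f (Fin.last n))]
        · have := isEnriched_snoc P f b
          simp only [Fin.snocEquiv, Equiv.coe_fn_mk, Fin.snoc_last, and_true] at this ⊢
          rw [← ite_and]
          exact if_congr (this.trans and_comm) rfl rfl
        · intro b' _ hb'
          simp [hb'.symm]
        · simp
      rw [Finset.sum_congr rfl fun f _ => h1 f, Finset.sum_comm]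
      have h2 : ∀ b' : Fin K, (∑ f : Fin (n + 1) → Fin K,
          if (b' < b ∨ b' = b ∧ (Odd (b : ℕ) ↔ P n)) then
            (if IsEnriched P f ∧ f (Fin.last n) = b' then 1 else 0) else 0) =
          (if (b' : ℕ) < b then enrichedCount P n b' else 0) +
          if b' = b then (if Odd (b : ℕ) ↔ P n then enrichedCount P n b else 0) else 0 := by
        intro b'
        by_cases hlt : b' < b
        · have : b' ≠ b := hlt.ne
          simp only [hlt, true_or, if_true, ih, Fin.lt_def.mp hlt, this, if_false, add_zero]
        · by_cases heq : b' = b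
          · subst heq
            by_cases ho : (Odd (b' : ℕ) ↔ P n)
            · simp only [lt_irrefl, ho, false_or, true_and, if_true, ih, if_false, zero_add]
            · simp [ho]
          · have : ¬ ((b' : ℕ) < b) := hlt
            simp [hlt, heq, this]
      rw [Finset.sum_congr rfl fun b' _ => h2 b', Finset.sum_add_distrib, enrichedCount]
      congr 1
      · rw [Fin.sum_univ_eq_sum_range
          (fun i => if i < (b : ℕ) then enrichedCount P n i else 0), ← Finset.sum_filter]
        congr 1
        ext i
        have := b.2
        simp only [Finset.mem_filter, Finset.mem_range]
        omega
      · simp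
    · intro b' _ hb'
      refine Finset.sum_eq_zero fun f _ => if_neg ?_
      rintro ⟨-, h⟩
      simp only [Fin.snocEquiv, Equiv.coe_fn_mk, Fin.snoc_last] at h
      exact hb' h
    · simp

theorem enrichedCard_succ (P : ℕ → Prop) (n K : ℕ) :
    enrichedCard P (n + 1) K = ∑ b ∈ Finset.range K, enrichedCount P n b := by
  classical
  rw [enrichedCard, Finset.card_filter, ← Fin.sum_univ_eq_sum_range,
    ← Finset.sum_congr rfl fun b _ => sum_last_isEnriched P K n b, Finset.sum_comm]
  refine Finset.sum_congr rfl fun f _ => ?_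
  simp [ite_and]

theorem enrichedCard_zero (P : ℕ → Prop) (K : ℕ) : enrichedCard P 0 K = 1 := by
  simp [enrichedCard, IsEnriched]

end EnrichedCount

/-! ### Generating functions of enriched sequences and peaks -/

section EnrichedSeries

variable (R : Type*) [CommRing R] (P : ℕ → Prop)

/-- The generating function of the numbers of enriched sequences of length `n + 1` in the `2 k`
letters `±1, …, ±k`. -/
noncomputable def enrichedSeries (n : ℕ) : R⟦X⟧ :=
  PowerSeries.mk fun k => (enrichedCard P (n + 1) (2 * k) : R)

/-- The generating function of the numbers of enriched sequences of length `n + 1` ending in `-k`. -/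
noncomputable def negSeries (n : ℕ) : R⟦X⟧ :=
  PowerSeries.X * PowerSeries.mk fun k => (enrichedCount P n (2 * k) : R)

/-- The generating function of the numbers of enriched sequences of length `n + 1` ending in `k`. -/
noncomputable def posSeries (n : ℕ) : R⟦X⟧ :=
  PowerSeries.X * PowerSeries.mk fun k => (enrichedCount P n (2 * k + 1) : R)

theorem one_sub_X_mul_enrichedSeries (n : ℕ) :
    (1 - PowerSeries.X) * enrichedSeries R P n = negSeries R P n + posSeries R P n := by
  ext k
  rcases k with _ | k
  · simp [enrichedSeries, negSeries, posSeries, enrichedCard_succ]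
  · rw [sub_mul, one_mul, map_sub, map_add, negSeries, posSeries, PowerSeries.coeff_succ_X_mul,
      PowerSeries.coeff_succ_X_mul, PowerSeries.coeff_succ_X_mul]
    simp only [enrichedSeries, PowerSeries.coeff_mk, enrichedCard_succ]
    rw [show 2 * (k + 1) = 2 * k + 1 + 1 by ring, Finset.sum_range_succ, Finset.sum_range_succ]
    push_cast
    ring

/-- In this and the next three lemmas, the predecessors of a last letter are all smaller letters,
together with the letter itself if its parity fits the step. The letters below `2k` form a full
alphabet of `2k` letters, as do those up to `2k + 1` of `2k + 2` letters; the extra factor `X`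
records the difference. -/
theorem negSeries_succ_of_mem {n : ℕ} (h : P n) :
    negSeries R P (n + 1) = PowerSeries.X * enrichedSeries R P n := by
  rw [negSeries]
  congr 1
  ext k
  have : ¬ Odd (2 * k) := by simp
  simp [enrichedSeries, enrichedCard_succ, enrichedCount, h, this]

theorem posSeries_succ_of_mem {n : ℕ} (h : P n) :
    posSeries R P (n + 1) = enrichedSeries R P n := by
  rw [posSeries]
  ext k
  rcases k with _ | k
  · simp [enrichedSeries, enrichedCard_succ]
  · rw [PowerSeries.coeff_succ_X_mul]
    have : Odd (2 * k + 1) := odd_two_mul_add_one k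
    simp only [enrichedSeries, enrichedCard_succ, enrichedCount, h, this, PowerSeries.coeff_mk,
      if_true]
    rw [show 2 * (k + 1) = 2 * k + 1 + 1 by ring, ← Finset.sum_range_succ]

theorem negSeries_succ_of_notMem {n : ℕ} (h : ¬ P n) :
    negSeries R P (n + 1) = PowerSeries.X * enrichedSeries R P n + negSeries R P n := by
  rw [negSeries, negSeries, ← mul_add]
  congr 1
  ext k
  simp [enrichedSeries, enrichedCard_succ, enrichedCount, h]

theorem posSeries_succ_of_notMem {n : ℕ} (h : ¬ P n) :
    posSeries R P (n + 1) = PowerSeries.X * enrichedSeries R P n + negSeries R P n := by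
  rw [posSeries, negSeries, ← mul_add]
  congr 1
  ext k
  simp [enrichedSeries, enrichedCard_succ, enrichedCount, h, Finset.sum_range_succ]

theorem one_sub_X_mul_enrichedSeries_succ {n : ℕ} (h : P n) :
    (1 - PowerSeries.X) * enrichedSeries R P (n + 1) =
      (1 + PowerSeries.X) * enrichedSeries R P n := by
  rw [one_sub_X_mul_enrichedSeries, negSeries_succ_of_mem R P h, posSeries_succ_of_mem R P h]
  ring

/-- The number of peaks of a sequence of `n + 1` letters with the set `P` of ascents. -/
noncomputable def peakCount (P : ℕ → Prop) : ℕ → ℕ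
  | 0 => 0
  | 1 => 0
  | n + 2 => peakCount P (n + 1) + open Classical in if P n ∧ ¬ P (n + 1) then 1 else 0

open Classical in
/-- The relation between `negSeries` and `posSeries` after a step that is (or is not) an ascent. -/
theorem negSeries_relation (n : ℕ) :
    if 1 ≤ n ∧ P (n - 1) then
      (1 + PowerSeries.X) * negSeries R P n = PowerSeries.X * (1 - PowerSeries.X) *
        enrichedSeries R P n
    else negSeries R P n = posSeries R P n := by
  rcases n with _ | n
  · simp [negSeries, posSeries, enrichedCount]
  · by_cases h : P n
    · have h2 := one_sub_X_mul_enrichedSeries R P (n + 1)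
      rw [posSeries_succ_of_mem R P h, negSeries_succ_of_mem R P h] at h2
      rw [if_pos ⟨by omega, h⟩, negSeries_succ_of_mem R P h, mul_assoc, h2]
      ring
    · rw [if_neg (by simp [h]), negSeries_succ_of_notMem R P h, posSeries_succ_of_notMem R P h]

-- Each step contributes a factor `A`, and a descent directly after an ascent contributes a further
-- `u`. Hence only the number of peaks of the ascent set matters.
variable {R P} in
theorem two_mul_enrichedSeries {A u : R⟦X⟧} (hA : (1 - PowerSeries.X) * A = 1 + PowerSeries.X)
    (hu : (1 + PowerSeries.X) ^ 2 * u = 4 * PowerSeries.X)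
    (h1 : IsUnit (1 - PowerSeries.X : R⟦X⟧)) (h2 : IsUnit (1 + PowerSeries.X : R⟦X⟧)) (n : ℕ) :
    2 * enrichedSeries R P n = A ^ (n + 2) * u ^ (peakCount P n + 1) := by
  classical
  have step : ∀ n, enrichedSeries R P (n + 1) =
      A * u ^ (if 1 ≤ n ∧ P (n - 1) ∧ ¬ P n then 1 else 0) * enrichedSeries R P n := by
    intro n
    have e0 := one_sub_X_mul_enrichedSeries R P n
    have e1 := one_sub_X_mul_enrichedSeries R P (n + 1)
    have r := negSeries_relation R P n
    apply h1.mul_left_cancel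
    by_cases h : P n
    · rw [if_neg (by simp [h]), one_sub_X_mul_enrichedSeries_succ R P h]
      linear_combination (-enrichedSeries R P n) * hA
    · rw [e1, negSeries_succ_of_notMem R P h, posSeries_succ_of_notMem R P h]
      -- With `E` and `N` for `enrichedSeries` and `negSeries` at `n`, the left side is now `2(X E +
      -- N)`. After an ascent `N = X(1-X)E/(1+X)`, which gives `4X E/(1+X) = (1+X) u E`; otherwise
      -- `2N = (1-X)E`, which gives `(1+X) E`.
      by_cases h' : 1 ≤ n ∧ P (n - 1)
      · rw [if_pos h'] at r
        rw [if_pos ⟨h'.1, h'.2, h⟩]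
        apply h2.mul_left_cancel
        linear_combination 2 * r - enrichedSeries R P n * hu -
          (1 + PowerSeries.X) * u * enrichedSeries R P n * hA
      · rw [if_neg h'] at r
        rw [if_neg (by tauto)]
        linear_combination r - (enrichedSeries R P n) * hA - e0
  have zero : 2 * enrichedSeries R P 0 = A ^ 2 * u := by
    have e0 := one_sub_X_mul_enrichedSeries R P 0
    have hn : (1 - PowerSeries.X) * negSeries R P 0 = PowerSeries.X := by
      have := PowerSeries.mk_one_mul_one_sub_eq_one R
      simp only [negSeries, enrichedCount, Nat.cast_one]
      calc _ = PowerSeries.X * ((PowerSeries.mk 1 : R⟦X⟧) * (1 - PowerSeries.X)) := by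
            change (1 - PowerSeries.X) * (PowerSeries.X * (PowerSeries.mk 1 : R⟦X⟧)) = _
            ring
        _ = _ := by rw [this, mul_one]
    have r := negSeries_relation R P 0
    rw [if_neg (by simp)] at r
    apply (h1.pow 2).mul_left_cancel
    linear_combination 2 * (1 - PowerSeries.X) * e0 + 4 * hn - 2 * (1 - PowerSeries.X) * r
      - u * ((1 - PowerSeries.X) * A + 1 + PowerSeries.X) * hA - hu
  induction n with
  | zero => simpa [peakCount] using zero
  | succ n ih =>
    have hp : peakCount P (n + 1) =
        peakCount P n + if 1 ≤ n ∧ P (n - 1) ∧ ¬ P n then 1 else 0 := by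
      rcases n with _ | n
      · simp [peakCount]
      · simp [peakCount]
    rw [step, hp]
    linear_combination A * u ^ (if 1 ≤ n ∧ P (n - 1) ∧ ¬ P n then 1 else 0) * ih

end EnrichedSeries

/-! ### Standardization of words -/

section Words

/-- The ascents of a word in the letters `0, 1, 2, 3, …` (standing for `-1, 1, -2, 2, …`): odd
letters, but not even letters, may be repeated in an ascent. -/
def WordAsc {K n : ℕ} (w : Fin n → Fin K) (i : ℕ) : Prop :=
  ∃ h : i + 1 < n, w ⟨i, by omega⟩ < w ⟨i + 1, h⟩ ∨
    w ⟨i, by omega⟩ = w ⟨i + 1, h⟩ ∧ Odd (w ⟨i, by omega⟩ : ℕ)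

/-- The ascents of a permutation. -/
def PermAsc {n : ℕ} (π : Equiv.Perm (Fin n)) (i : ℕ) : Prop :=
  ∃ h : i + 1 < n, π ⟨i, by omega⟩ < π ⟨i + 1, h⟩

open Classical in
/-- The number of positions from `l` on where `m` letters in ascending order begin, in a sequence of
length `n` with ascents `P`. -/
noncomputable def occFrom (m n : ℕ) (P : ℕ → Prop) (l : ℕ) : ℕ :=
  ((Finset.range (n + 1)).filter fun i =>
    l ≤ i ∧ i + m ≤ n ∧ ∀ j, j + 1 < m → P (i + j)).card

theorem occursAt_mono_iff {m n : ℕ} (π : Equiv.Perm (Fin n)) (i : ℕ) :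
    OccursAt (mono m) π i ↔ i + m ≤ n ∧ ∀ j, j + 1 < m → PermAsc π (i + j) := by
  constructor
  · rintro ⟨h, H⟩
    refine ⟨h, fun j hj => ⟨by omega, ?_⟩⟩
    have := (H ⟨j, by omega⟩ ⟨j + 1, hj⟩).2 (by simp [mono])
    exact this
  · rintro ⟨h, H⟩
    refine ⟨h, ?_⟩
    have hs : StrictMono fun a : Fin m => π ⟨i + a, by omega⟩ := by
      rcases m with _ | m
      · exact fun a => a.elim0
      · refine Fin.strictMono_iff_lt_succ.2 fun a => ?_
        obtain ⟨_, h2⟩ := H a (by omega)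
        exact h2
    exact fun a b => hs.lt_iff_lt

theorem occ_mono_eq {m n : ℕ} (π : Equiv.Perm (Fin n)) :
    occ (mono m) π = occFrom m n (PermAsc π) 0 := by
  classical
  rw [occ, occFrom]
  congr 1
  ext i
  simp [occursAt_mono_iff]

theorem occFrom_congr {m n l : ℕ} {P Q : ℕ → Prop} (h : ∀ i, l ≤ i → i + 1 < n → (P i ↔ Q i)) :
    occFrom m n P l = occFrom m n Q l := by
  classical
  rw [occFrom, occFrom]
  congr 1
  ext i
  simp only [Finset.mem_filter]
  refine and_congr_right fun _ => and_congr_right fun h1 => and_congr_right fun h2 => ?_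
  exact forall_congr' fun j => forall_congr' fun hj => h _ (by omega) (by omega)

theorem peakCount_eq_pk {n : ℕ} (π : Equiv.Perm (Fin (n + 1))) :
    peakCount (PermAsc π) n = pk π := by
  classical
  -- The guard `i + 1 < j` is essential: `PermAsc` is false beyond the last pair of positions, where
  -- its negation does not mean a descent.
  have h1 : ∀ j, peakCount (PermAsc π) j = ((Finset.range j).filter fun i =>
      i + 1 < j ∧ PermAsc π i ∧ ¬ PermAsc π (i + 1)).card := by
    intro j
    induction j with
    | zero => simp [peakCount]
    | succ j ih =>
      rcases j with _ | j
      · simp [peakCount]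
      · conv_rhs => rw [Finset.range_add_one, Finset.filter_insert, if_neg (by omega),
          Finset.range_add_one, Finset.filter_insert]
        rw [Finset.range_add_one, Finset.filter_insert, if_neg (by omega)] at ih
        rw [peakCount, ih]
        have e : (Finset.range j).filter
            (fun i => i + 1 < j + 1 + 1 ∧ PermAsc π i ∧ ¬ PermAsc π (i + 1)) =
            (Finset.range j).filter
            (fun i => i + 1 < j + 1 ∧ PermAsc π i ∧ ¬ PermAsc π (i + 1)) := by
          refine Finset.filter_congr fun i hi => ?_
          have := Finset.mem_range.1 hi
          exact and_congr_left fun _ => by omega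
        rw [e]
        by_cases h : PermAsc π j ∧ ¬ PermAsc π (j + 1)
        · rw [if_pos h, if_pos ⟨by omega, h⟩, Finset.card_insert_of_notMem (by simp)]
        · rw [if_neg h, if_neg (fun h' => h h'.2), add_zero]
  rw [h1, pk, Finset.range_add_one, Finset.filter_insert,
    if_neg (by rintro ⟨h, -⟩; omega)]
  congr 1
  refine Finset.filter_congr fun i hi => ?_
  constructor
  · rintro ⟨h, ⟨h1, h2⟩, h3⟩
    refine ⟨by omega, h2, ?_⟩
    have h4 : ¬ π ⟨i + 1, by omega⟩ < π ⟨i + 1 + 1, by omega⟩ := fun h5 => h3 ⟨by omega, h5⟩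
    refine lt_of_le_of_ne (not_lt.1 h4) fun h5 => ?_
    have := congrArg Fin.val (π.injective h5)
    simp at this
  · rintro ⟨h, h1, h2⟩
    exact ⟨by omega, ⟨by omega, h1⟩, fun ⟨_, h3⟩ => lt_asymm h2 h3⟩

/-- The positions of a word are sorted by this key in its standardization: by letters, equal odd
letters from left to right, and equal even letters from right to left. -/
def stdKey {K n : ℕ} (w : Fin n → Fin K) (i : Fin n) : ℕ ×ₗ ℤ :=
  toLex ((w i : ℕ), if Odd (w i : ℕ) then (i : ℤ) else -(i : ℤ))

theorem stdKey_lt_iff {K n : ℕ} (w : Fin n → Fin K) (i j : Fin n) :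
    stdKey w i < stdKey w j ↔
      w i < w j ∨ w i = w j ∧ if Odd (w i : ℕ) then i < j else j < i := by
  rw [stdKey, stdKey, Prod.Lex.toLex_lt_toLex]
  refine or_congr Iff.rfl ?_
  simp only [← Fin.ext_iff]
  refine and_congr_right fun h => ?_
  rw [← h]
  split_ifs
  · simp
  · simp

theorem stdKey_injective {K n : ℕ} (w : Fin n → Fin K) : Function.Injective (stdKey w) := by
  intro i j h
  rcases lt_trichotomy i j with hij | hij | hij
  · have h1 := (stdKey_lt_iff w i j).not.1 h.not_lt
    have h2 := (stdKey_lt_iff w j i).not.1 h.symm.not_lt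
    rcases lt_trichotomy (w i) (w j) with hw | hw | hw
    · exact absurd (Or.inl hw) h1
    · by_cases ho : Odd (w i : ℕ)
      · exact absurd (Or.inr ⟨hw, by rwa [if_pos ho]⟩) h1
      · exact absurd (Or.inr ⟨hw.symm, by rwa [← hw, if_neg ho]⟩) h2
    · exact absurd (Or.inl hw) h2
  · exact hij
  · have h1 := (stdKey_lt_iff w i j).not.1 h.not_lt
    have h2 := (stdKey_lt_iff w j i).not.1 h.symm.not_lt
    rcases lt_trichotomy (w i) (w j) with hw | hw | hw
    · exact absurd (Or.inl hw) h1
    · by_cases ho : Odd (w i : ℕ)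
      · exact absurd (Or.inr ⟨hw.symm, by rwa [← hw, if_pos ho]⟩) h2
      · exact absurd (Or.inr ⟨hw, by rwa [if_neg ho]⟩) h1
    · exact absurd (Or.inl hw) h2

/-- The standardization of a word. -/
def wordStd {K n : ℕ} (w : Fin n → Fin K) : Equiv.Perm (Fin n) := (Tuple.sort (stdKey w))⁻¹

theorem wordStd_eq_iff {K n : ℕ} (w : Fin n → Fin K) (π : Equiv.Perm (Fin n)) :
    wordStd w = π ↔ StrictMono (stdKey w ∘ (π⁻¹ : Equiv.Perm (Fin n))) := by
  rw [wordStd, inv_eq_iff_eq_inv, eq_comm, Tuple.eq_sort_iff]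
  -- The tie-breaking condition of `Tuple.sort` is vacuous, since the keys are distinct.
  constructor
  · rintro ⟨h, -⟩
    exact h.strictMono_of_injective ((stdKey_injective w).comp (Equiv.injective _))
  · intro h
    exact ⟨h.monotone, fun i j hij he => absurd he (h hij).ne⟩

/-- An ascent of a word is exactly an increase of `stdKey` between neighbouring positions, and `π`
orders the positions by this key. -/
theorem wordAsc_iff_permAsc {K n : ℕ} {w : Fin n → Fin K} {π : Equiv.Perm (Fin n)}
    (h : wordStd w = π) (i : ℕ) : WordAsc w i ↔ PermAsc π i := by
  have hs := (wordStd_eq_iff w π).1 h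
  refine exists_congr fun hi => ?_
  have := hs.lt_iff_lt (a := π ⟨i, by omega⟩) (b := π ⟨i + 1, hi⟩)
  simp only [Function.comp_apply, Equiv.Perm.inv_def, Equiv.symm_apply_apply, stdKey_lt_iff] at this
  rw [← this]
  refine or_congr_right (and_congr_right fun _ => ?_)
  have h1 : (⟨i, by omega⟩ : Fin n) < ⟨i + 1, hi⟩ := by simp
  have h2 : ¬ ((⟨i + 1, hi⟩ : Fin n) < ⟨i, by omega⟩) := not_lt.2 h1.le
  split_ifs with ho <;> simp [ho]

/-- The keys need only increase between neighbours in the order of `π⁻¹`. For equal letters this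
asks `π⁻¹` to ascend if the letter is odd and to descend if it is even; this is how the inverse of
`π` enters. -/
theorem wordStd_eq_iff_isEnriched {K n : ℕ} (w : Fin n → Fin K) (π : Equiv.Perm (Fin n)) :
    wordStd w = π ↔ IsEnriched (PermAsc π⁻¹) (w ∘ (π⁻¹ : Equiv.Perm (Fin n))) := by
  rw [wordStd_eq_iff]
  have key : ∀ i (h : i + 1 < n),
      (stdKey w ∘ (π⁻¹ : Equiv.Perm (Fin n))) ⟨i, by omega⟩ <
        (stdKey w ∘ (π⁻¹ : Equiv.Perm (Fin n))) ⟨i + 1, h⟩ ↔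
      (w ∘ (π⁻¹ : Equiv.Perm (Fin n))) ⟨i, by omega⟩ <
        (w ∘ (π⁻¹ : Equiv.Perm (Fin n))) ⟨i + 1, h⟩ ∨
      (w ∘ (π⁻¹ : Equiv.Perm (Fin n))) ⟨i, by omega⟩ =
        (w ∘ (π⁻¹ : Equiv.Perm (Fin n))) ⟨i + 1, h⟩ ∧
        (Odd ((w ∘ (π⁻¹ : Equiv.Perm (Fin n))) ⟨i, by omega⟩ : ℕ) ↔ PermAsc π⁻¹ i) := by
    intro i h
    simp only [Function.comp_apply, stdKey_lt_iff]
    refine or_congr_right (and_congr_right fun _ => ?_)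
    have hne : (π⁻¹ : Equiv.Perm (Fin n)) ⟨i, by omega⟩ ≠ (π⁻¹ : Equiv.Perm (Fin n)) ⟨i + 1, h⟩ :=
      fun h => by simpa using congrArg Fin.val ((π⁻¹ : Equiv.Perm (Fin n)).injective h)
    have ha : PermAsc π⁻¹ i ↔
        (π⁻¹ : Equiv.Perm (Fin n)) ⟨i, by omega⟩ < (π⁻¹ : Equiv.Perm (Fin n)) ⟨i + 1, h⟩ :=
      ⟨fun ⟨_, h'⟩ => h', fun h' => ⟨h, h'⟩⟩
    rw [ha]
    split_ifs with ho
    · simp only [ho, true_iff]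
    · simp only [ho, false_iff, not_lt]
      exact ⟨le_of_lt, fun h => lt_of_le_of_ne h hne.symm⟩
  constructor
  · intro hs i h
    exact (key i h).1 (hs (by simp))
  · intro H
    rcases n with _ | n
    · exact fun a => a.elim0
    · exact Fin.strictMono_iff_lt_succ.2 fun a => (key a (by omega)).2 (H a (by omega))

theorem card_wordStd_eq {n : ℕ} (K : ℕ) (π : Equiv.Perm (Fin n)) :
    (Finset.univ.filter fun w : Fin n → Fin K => wordStd w = π).card =
      enrichedCard (PermAsc π⁻¹) n K := by
  classical
  rw [enrichedCard]
  refine Finset.card_equiv (Equiv.arrowCongr π (Equiv.refl _)) fun w => ?_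
  simp only [Finset.mem_filter, Finset.mem_univ, true_and]
  exact wordStd_eq_iff_isEnriched w π

variable {B : Type*} [CommRing B]

/-- The sum of `a ^ occ w` over the words `w` of length `n` in `K` letters, where `occ w` is the
number of factors of `m` letters in ascending order. -/
noncomputable def wordSum (m : ℕ) (a : B) (K n : ℕ) : B :=
  ∑ w : Fin n → Fin K, a ^ occFrom m n (WordAsc w) 0

theorem wordSum_zero {m : ℕ} (hm : 2 ≤ m) (a : B) (K : ℕ) : wordSum m a K 0 = 1 := by
  have : ∀ P, occFrom m 0 P 0 = 0 := by
    intro P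
    classical
    rw [occFrom, Finset.card_eq_zero, Finset.filter_eq_empty_iff]
    intro i _ h
    omega
  simp [wordSum, this]

/-- The words are grouped by standardization, which preserves ascents and therefore the weight. -/
theorem wordSum_eq_sum_perm (m : ℕ) (a : B) (K n : ℕ) :
    wordSum m a K n =
      ∑ π : Equiv.Perm (Fin n), a ^ occ (mono m) π * (enrichedCard (PermAsc π⁻¹) n K : B) := by
  classical
  rw [wordSum, ← Finset.sum_fiberwise Finset.univ wordStd]
  refine Finset.sum_congr rfl fun π _ => ?_
  rw [← card_wordStd_eq, mul_comm, ← nsmul_eq_mul, ← Finset.sum_const]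
  refine Finset.sum_congr rfl fun w hw => ?_
  have h := (Finset.mem_filter.1 hw).2
  rw [occ_mono_eq, occFrom_congr fun i _ _ => wordAsc_iff_permAsc h i]

end Words

/-! ### The run theorem for words -/

section Runs

theorem isEnriched_true_iff {K n : ℕ} (f : Fin n → Fin K) :
    IsEnriched (fun _ => True) f ↔ ∀ j, j + 1 < n → WordAsc f j := by
  refine forall_congr' fun j => ⟨fun H h => ⟨h, ?_⟩, fun H h => ?_⟩
  · simpa only [iff_true] using H h
  · simpa only [iff_true] using (H h).2

theorem wordAsc_append_left {K l n : ℕ} (p : Fin l → Fin K) (q : Fin n → Fin K) {j : ℕ}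
    (hj : j + 1 < l) : WordAsc (Fin.append p q) j ↔ WordAsc p j := by
  have e : ∀ i (h : i < l), Fin.append p q ⟨i, by omega⟩ = p ⟨i, h⟩ :=
    fun i h => Fin.append_left p q ⟨i, h⟩
  simp only [WordAsc, e j (by omega), e (j + 1) hj]
  exact exists_prop_congr (fun _ => Iff.rfl) (by omega)

theorem wordAsc_append_right {K l n : ℕ} (p : Fin l → Fin K) (q : Fin n → Fin K) (j : ℕ) :
    WordAsc (Fin.append p q) (l + j) ↔ WordAsc q j := by
  have e : ∀ i (h : i < n), Fin.append p q ⟨l + i, by omega⟩ = q ⟨i, h⟩ :=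
    fun i h => Fin.append_right p q ⟨i, h⟩
  constructor
  · rintro ⟨h, H⟩
    refine ⟨by omega, ?_⟩
    have e' := e (j + 1) (by omega)
    simp only [← add_assoc] at e'
    rwa [e j (by omega), e'] at H
  · rintro ⟨h, H⟩
    refine ⟨by omega, ?_⟩
    have e' := e (j + 1) (by omega)
    simp only [← add_assoc] at e'
    rwa [e j (by omega), e']

theorem occFrom_add {m n l : ℕ} {P Q : ℕ → Prop} (h : ∀ j, P (l + j) ↔ Q j) :
    occFrom m (l + n) P l = occFrom m n Q 0 := by
  classical
  refine Finset.card_nbij' (fun i => i - l) (fun i => l + i) ?_ ?_ ?_ ?_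
  · intro i hi
    simp only [Finset.coe_filter, Finset.mem_range, Set.mem_ofPred_eq] at hi ⊢
    obtain ⟨h1, h2, h3, h4⟩ := hi
    refine ⟨by omega, by omega, by omega, fun j hj => (h _).1 ?_⟩
    rw [show l + (i - l + j) = i + j by omega]
    exact h4 j hj
  · intro i hi
    simp only [Finset.coe_filter, Finset.mem_range, Set.mem_ofPred_eq] at hi ⊢
    obtain ⟨h1, h2, h3, h4⟩ := hi
    refine ⟨by omega, by omega, by omega, fun j hj => ?_⟩
    rw [add_assoc]
    exact (h _).2 (h4 j hj)
  · intro i hi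
    simp only [Finset.coe_filter, Finset.mem_range, Set.mem_ofPred_eq] at hi
    exact Nat.add_sub_cancel' hi.2.1
  · intro i _
    exact Nat.add_sub_cancel_left (n := l) (m := i)

variable {B : Type*} [CommRing B]

-- A word is cut after its first `l` letters. Nothing is required at the cut, and only the
-- occurrences that begin after it are weighted.
open Classical in
theorem enrichedCard_mul_wordSum (m : ℕ) (a : B) (K : ℕ) {l i n : ℕ} (h : l + i = n) :
    (enrichedCard (fun _ => True) l K : B) * wordSum m a K i =
      ∑ w : Fin n → Fin K, if ∀ j, j + 1 < l → WordAsc w j then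
        a ^ occFrom m n (WordAsc w) l else 0 := by
  subst h
  rw [← (Fin.appendEquiv l i).sum_comp, Fintype.sum_prod_type, enrichedCard, Finset.card_filter,
    Nat.cast_sum, wordSum, Finset.sum_mul_sum]
  refine Finset.sum_congr rfl fun p _ => Finset.sum_congr rfl fun q _ => ?_
  have h1 : IsEnriched (fun _ => True) p ↔
      ∀ j, j + 1 < l → WordAsc (Fin.appendEquiv l i (p, q)) j := by
    rw [isEnriched_true_iff]
    exact forall_congr' fun j => forall_congr' fun hj => (wordAsc_append_left p q hj).symm
  have h2 : Fin.appendEquiv l i (p, q) = Fin.append p q := rfl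
  rw [h2] at h1 ⊢
  rw [occFrom_add (wordAsc_append_right p q), ← if_congr h1 rfl rfl]
  split_ifs <;> simp

/-- The weights of runs of length `r`. -/
noncomputable def runSeries (m : ℕ) (a : B) : B⟦X⟧ := PowerSeries.mk fun r => a ^ (r + 1 - m)

/-- Here `r` is the length of the initial maximal run. No occurrence crosses its end, so those
beginning in it are the `i` with `l ≤ i ≤ r - m`; the subtraction truncates to `0` when fewer than
`m` letters remain. -/
theorem occFrom_of_run {m n l r : ℕ} {P : ℕ → Prop} (hm : 1 ≤ m) (hl : l ≤ r) (hr : r ≤ n)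
    (h1 : ∀ j, j + 1 < r → P j) (h2 : r < n → 1 ≤ r ∧ ¬ P (r - 1)) :
    occFrom m n P l = (r - l + 1 - m) + occFrom m n P r := by
  classical
  have hset : (Finset.range (n + 1)).filter
      (fun i => l ≤ i ∧ i + m ≤ n ∧ ∀ j, j + 1 < m → P (i + j)) =
      Finset.Ico l (r + 1 - m) ∪ (Finset.range (n + 1)).filter
        (fun i => r ≤ i ∧ i + m ≤ n ∧ ∀ j, j + 1 < m → P (i + j)) := by
    ext i
    simp only [Finset.mem_union, Finset.mem_filter, Finset.mem_range, Finset.mem_Ico]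
    constructor
    · rintro ⟨hi, hli, him, H⟩
      by_cases hir : r ≤ i
      · exact Or.inr ⟨hi, hir, him, H⟩
      · refine Or.inl ⟨hli, ?_⟩
        by_contra hlt
        obtain ⟨hr1, hn⟩ := h2 (by omega)
        have := H (r - 1 - i) (by omega)
        rw [show i + (r - 1 - i) = r - 1 by omega] at this
        exact hn this
    · rintro (⟨hli, hi⟩ | ⟨hi, hri, him, H⟩)
      · exact ⟨by omega, hli, by omega, fun j hj => h1 _ (by omega)⟩
      · exact ⟨hi, by omega, him, H⟩
  have hdisj : Disjoint (Finset.Ico l (r + 1 - m)) ((Finset.range (n + 1)).filter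
      (fun i => r ≤ i ∧ i + m ≤ n ∧ ∀ j, j + 1 < m → P (i + j))) := by
    rw [Finset.disjoint_left]
    intro i hi hi'
    have h3 := (Finset.mem_Ico.1 hi).2
    have h4 := (Finset.mem_filter.1 hi').2.1
    omega
  rw [occFrom, hset, Finset.card_union_of_disjoint hdisj, Nat.card_Ico, occFrom,
    show r + 1 - m - l = r - l + 1 - m by omega]

-- All cuts of one word cancel. Only cuts inside the initial run, of length `r`, contribute, and
-- their sum is the coefficient of degree `r` in `V * runSeries m a` times a common power of `a`; it
-- vanishes because `r ≥ 1`.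
open Classical in
theorem sum_coeff_mul_occFrom_eq_zero {m : ℕ} {a : B} {V : B⟦X⟧}
    (hV : V * runSeries m a = 1) (hm : 1 ≤ m) {n : ℕ} (hn : 1 ≤ n) (P : ℕ → Prop) :
    ∑ l ∈ Finset.range (n + 1), PowerSeries.coeff l V *
      (if ∀ j, j + 1 < l → P j then a ^ occFrom m n P l else 0) = 0 := by
  set r := Nat.findGreatest (fun l => ∀ j, j + 1 < l → P j) n with hrdef
  have hrn : r ≤ n := Nat.findGreatest_le n
  have hr : ∀ j, j + 1 < r → P j :=
    Nat.findGreatest_spec (P := fun l => ∀ j, j + 1 < l → P j) (Nat.zero_le n) (by simp)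
  have hr1 : 1 ≤ r := Nat.le_findGreatest hn (by simp)
  have hgt : ∀ l, r < l → l ≤ n → ¬ ∀ j, j + 1 < l → P j :=
    fun l h1 h2 => Nat.findGreatest_is_greatest h1 h2
  have hP : r < n → 1 ≤ r ∧ ¬ P (r - 1) := by
    refine fun h => ⟨hr1, fun hp => hgt (r + 1) (by omega) (by omega) fun j hj => ?_⟩
    rcases Nat.lt_or_ge (j + 1) r with h' | h'
    · exact hr j h'
    · rwa [show j = r - 1 by omega]
  have hsub : Finset.range (r + 1) ⊆ Finset.range (n + 1) :=
    Finset.range_subset_range.2 (by omega)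
  rw [← Finset.sum_subset hsub]
  · have hc : PowerSeries.coeff r (V * runSeries m a) = 0 := by
      rw [hV, PowerSeries.coeff_one, if_neg (by omega)]
    rw [PowerSeries.coeff_mul, Finset.Nat.sum_antidiagonal_eq_sum_range_succ
      (fun i j => PowerSeries.coeff i V * PowerSeries.coeff j (runSeries m a))] at hc
    calc _ = ∑ l ∈ Finset.range (r + 1), PowerSeries.coeff l V *
          PowerSeries.coeff (r - l) (runSeries m a) * a ^ occFrom m n P r := by
          refine Finset.sum_congr rfl fun l hl => ?_
          have hl' : l ≤ r := by have := Finset.mem_range.1 hl; omega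
          rw [if_pos fun j hj => hr j (by omega), occFrom_of_run hm hl' hrn hr hP, pow_add,
            runSeries, PowerSeries.coeff_mk, mul_assoc]
      _ = 0 := by rw [← Finset.sum_mul, hc, zero_mul]
  · intro l hl hl'
    rw [Finset.mem_range] at hl hl'
    rw [if_neg (hgt l (by omega) (by omega)), mul_zero]

/-- The run theorem for words: the generating function of words by the weights of their maximal
ascending runs is the reciprocal of a weighted generating function of ascending words. -/
theorem mk_wordSum_mul_eq_one {m : ℕ} (hm : 2 ≤ m) {a : B} {V : B⟦X⟧}
    (hV : V * runSeries m a = 1) (K : ℕ) :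
    (PowerSeries.mk fun l => PowerSeries.coeff l V * (enrichedCard (fun _ => True) l K : B)) *
      PowerSeries.mk (wordSum m a K) = 1 := by
  classical
  ext n
  rw [PowerSeries.coeff_mul]
  simp only [PowerSeries.coeff_mk]
  rcases Nat.eq_zero_or_pos n with rfl | hn
  · have h0 := congrArg PowerSeries.constantCoeff hV
    simp only [runSeries, map_mul, ← PowerSeries.coeff_zero_eq_constantCoeff_apply,
      PowerSeries.coeff_mk, map_one] at h0
    rw [show 0 + 1 - m = 0 by omega, pow_zero, mul_one] at h0
    simp [wordSum_zero hm, enrichedCard_zero, h0]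
  · rw [PowerSeries.coeff_one, if_neg hn.ne']
    calc _ = ∑ p ∈ Finset.HasAntidiagonal.antidiagonal n, ∑ w : Fin n → Fin K, PowerSeries.coeff p.1 V *
          (if ∀ j, j + 1 < p.1 → WordAsc w j then a ^ occFrom m n (WordAsc w) p.1 else 0) := by
          refine Finset.sum_congr rfl fun p hp => ?_
          rw [mul_assoc, enrichedCard_mul_wordSum m a K (Finset.HasAntidiagonal.mem_antidiagonal.1 hp),
            Finset.mul_sum]
      _ = 0 := by
          rw [Finset.sum_comm]
          refine Finset.sum_eq_zero fun w _ => ?_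
          rw [Finset.Nat.sum_antidiagonal_eq_sum_range_succ (fun i _ => PowerSeries.coeff i V *
            (if ∀ j, j + 1 < i → WordAsc w j then a ^ occFrom m n (WordAsc w) i else 0))]
          exact sum_coeff_mul_occFrom_eq_zero hV (by omega) hn _

/-- The reciprocal `V` of `runSeries` satisfies `V = (1 - a y) / (1 - (a - 1) ∑_{l=1}^{m-1} y^l)`. -/
theorem runSeries_mul (m : ℕ) (hm : 2 ≤ m) (a : B) :
    runSeries m a * (1 - PowerSeries.C a * PowerSeries.X) =
      1 - (PowerSeries.C a - 1) * ∑ l ∈ Finset.Icc 1 (m - 1), (PowerSeries.X : B⟦X⟧) ^ l := by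
  have e : PowerSeries.C a - 1 = (PowerSeries.C (a - 1) : B⟦X⟧) := by simp
  rw [e]
  ext r
  rw [mul_sub, mul_one, map_sub, map_sub, PowerSeries.coeff_C_mul, map_sum]
  simp only [PowerSeries.coeff_X_pow, Finset.sum_ite_eq, Finset.mem_Icc]
  rcases r with _ | r
  · rw [show runSeries m a * (PowerSeries.C a * PowerSeries.X) =
      runSeries m a * PowerSeries.C a * PowerSeries.X by ring, PowerSeries.coeff_zero_mul_X]
    simp [runSeries, show 0 + 1 - m = 0 by omega]
  · rw [show runSeries m a * (PowerSeries.C a * PowerSeries.X) =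
      PowerSeries.C a * runSeries m a * PowerSeries.X by ring, PowerSeries.coeff_succ_mul_X,
      PowerSeries.coeff_C_mul, PowerSeries.coeff_one, if_neg (by omega)]
    simp only [runSeries, PowerSeries.coeff_mk]
    by_cases h : r + 1 ≤ m - 1
    · rw [if_pos (by omega), show r + 1 + 1 - m = 0 by omega, show r + 1 - m = 0 by omega]
      ring
    · rw [if_neg (by omega), show r + 1 + 1 - m = r + 1 - m + 1 by omega]
      ring

end Runs

/-! ### Counting ascending words -/

section Chains

theorem peakCount_true (n : ℕ) : peakCount (fun _ => True) n = 0 := by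
  induction n with
  | zero => rfl
  | succ n ih =>
    rcases n with _ | n
    · rfl
    · rw [peakCount, ih, if_neg (by simp)]

theorem isUnit_one_sub_X (R : Type*) [CommRing R] : IsUnit (1 - PowerSeries.X : R⟦X⟧) := by
  simp [PowerSeries.isUnit_iff_constantCoeff]

theorem isUnit_one_add_X (R : Type*) [CommRing R] : IsUnit (1 + PowerSeries.X : R⟦X⟧) := by
  simp [PowerSeries.isUnit_iff_constantCoeff]

variable {R : Type*} [CommRing R]

theorem one_sub_X_pow_mul_enrichedSeries_true (h2 : IsUnit (2 : R)) (n : ℕ) :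
    (1 - PowerSeries.X) ^ (n + 2) * enrichedSeries R (fun _ => True) n =
      2 * PowerSeries.X * (1 + PowerSeries.X) ^ n := by
  obtain ⟨A, hA⟩ : 1 - PowerSeries.X ∣ (1 + PowerSeries.X : R⟦X⟧) := (isUnit_one_sub_X R).dvd
  obtain ⟨u, hu⟩ : (1 + PowerSeries.X) ^ 2 ∣ (4 * PowerSeries.X : R⟦X⟧) :=
    ((isUnit_one_add_X R).pow 2).dvd
  rw [eq_comm] at hA hu
  have h2' : IsUnit (2 : R⟦X⟧) := by rwa [PowerSeries.isUnit_iff_constantCoeff, map_ofNat]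
  have h := two_mul_enrichedSeries (P := fun _ => True) hA hu (isUnit_one_sub_X R)
    (isUnit_one_add_X R) n
  rw [peakCount_true, zero_add, pow_one] at h
  apply h2'.mul_left_cancel
  calc _ = (1 - PowerSeries.X) ^ (n + 2) * (2 * enrichedSeries R (fun _ => True) n) := by ring
    _ = ((1 - PowerSeries.X) * A) ^ (n + 2) * u := by rw [h, mul_pow, mul_assoc]
    _ = (1 + PowerSeries.X) ^ n * ((1 + PowerSeries.X) ^ 2 * u) := by rw [hA]; ring
    _ = _ := by rw [hu]; ring

/-- This is the coefficient of `t^k` in `2t(1+t)^n/(1-t)^(n+2)`, extracted over `ℚ`, where `2` is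
invertible. -/
theorem enrichedCard_true_succ (n k : ℕ) :
    enrichedCard (fun _ => True) (n + 1) (2 * k) =
      2 * ∑ l ∈ Finset.Icc 1 k, (l + n).choose (l - 1) * n.choose (k - l) := by
  have h := one_sub_X_pow_mul_enrichedSeries_true (R := ℚ) (isUnit_iff_ne_zero.2 two_ne_zero) n
  have hb := PowerSeries.mk_add_choose_mul_one_sub_pow_eq_one ℚ (n + 1)
  have hS : enrichedSeries ℚ (fun _ => True) n = PowerSeries.X * (2 * (
      (PowerSeries.mk fun i => ((n + 1 + i).choose (n + 1) : ℚ)) *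
        (((1 + Polynomial.X) ^ n : Polynomial ℚ) : ℚ⟦X⟧))) := by
    calc _ = ((PowerSeries.mk fun i => ((n + 1 + i).choose (n + 1) : ℚ)) *
          (1 - PowerSeries.X) ^ (n + 2)) * enrichedSeries ℚ (fun _ => True) n := by
          rw [hb, one_mul]
      _ = _ := by
          rw [mul_assoc, h]
          push_cast
          ring
  have hk := congrArg (PowerSeries.coeff k) hS
  rw [enrichedSeries, PowerSeries.coeff_mk] at hk
  rcases k with _ | k
  · simp [enrichedCard_succ]
  · rw [PowerSeries.coeff_succ_X_mul, show (2 : ℚ⟦X⟧) = PowerSeries.C 2 from rfl,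
      PowerSeries.coeff_C_mul, PowerSeries.coeff_mul,
      Finset.Nat.sum_antidiagonal_eq_sum_range_succ_mk] at hk
    simp only [PowerSeries.coeff_mk, Polynomial.coeff_coe, Polynomial.coeff_one_add_X_pow] at hk
    have e : ∀ f : ℕ → ℕ, ∑ l ∈ Finset.Icc 1 (k + 1), f l = ∑ i ∈ Finset.range (k + 1), f (1 + i) := by
      intro f
      rw [← Finset.Ico_add_one_right_eq_Icc, Finset.sum_Ico_eq_sum_range]
      rfl
    have : (enrichedCard (fun _ => True) (n + 1) (2 * (k + 1)) : ℚ) = (2 * ∑ l ∈ Finset.Icc 1 (k + 1),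
        (l + n).choose (l - 1) * n.choose (k + 1 - l) : ℕ) := by
      rw [hk, e]
      push_cast
      congr 1
      refine Finset.sum_congr rfl fun i _ => ?_
      rw [show k + 1 - (1 + i) = k - i by omega, show 1 + i + n = n + 1 + i by omega,
        show 1 + i - 1 = i by omega, Nat.choose_symm_add]
    exact_mod_cast this

end Chains

/-! ### Substituting ascending words for powers of a variable -/

section Substitution

theorem hasSum_C_mul_X_pow_succ {R : Type*} [CommRing R] [TopologicalSpace R] (f : ℕ → R) :
    HasSum (fun k => PowerSeries.C (f k) * (PowerSeries.X : R⟦X⟧) ^ (k + 1))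
      (PowerSeries.X * PowerSeries.mk f) := by
  rw [PowerSeries.WithPiTopology.hasSum_iff_hasSum_coeff]
  intro d
  simp only [PowerSeries.coeff_C_mul, PowerSeries.coeff_X_pow]
  rcases d with _ | d
  · simp [hasSum_zero]
  · rw [PowerSeries.coeff_succ_X_mul, PowerSeries.coeff_mk]
    convert hasSum_single d ?_ using 1
    · simp
    · intro k hk
      simp [hk.symm]

/-- Replaces `y ^ l` by the generating function of the words of length `l` in ascending order,
which is `2t/(1-t^2) z^l` if `l ≥ 1` and `1/(1-t)` if `l = 0`. -/
noncomputable def chainSubst : SX →+ SXT where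
  toFun χ := PowerSeries.mk fun k => PowerSeries.mk fun l =>
    PowerSeries.coeff l χ * (enrichedCard (fun _ => True) l (2 * k) : ℚ[X])
  map_zero' := by
    ext k l : 2
    simp
  map_add' χ ω := by
    ext k l : 2
    simp [add_mul]

theorem coeff_coeff_chainSubst (χ : SX) (k l : ℕ) :
    PowerSeries.coeff l (PowerSeries.coeff k (chainSubst χ)) =
      PowerSeries.coeff l χ * (enrichedCard (fun _ => True) l (2 * k) : ℚ[X]) := by
  simp [chainSubst]

theorem chainSubst_C_mul (b : ℚ[X]) (χ : SX) :
    chainSubst (PowerSeries.C b * χ) = PowerSeries.C (PowerSeries.C b) * chainSubst χ := by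
  ext k l : 2
  simp only [coeff_coeff_chainSubst, PowerSeries.coeff_C_mul]
  ring

theorem isUnit_iff_isUnit_constantCoeff (f : SXT) :
    IsUnit f ↔ IsUnit (PowerSeries.constantCoeff (PowerSeries.constantCoeff f)) := by
  rw [PowerSeries.isUnit_iff_constantCoeff, PowerSeries.isUnit_iff_constantCoeff]

theorem isUnit_two : IsUnit (2 : SXT) := by
  have h : IsUnit (algebraMap ℚ SXT 2) := (isUnit_iff_ne_zero.2 two_ne_zero).map _
  rwa [map_ofNat] at h

theorem isUnit_one_sub_t : IsUnit (1 - t) := isUnit_one_sub_X _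

theorem isUnit_one_add_t : IsUnit (1 + t) := isUnit_one_add_X _

theorem isUnit_one_sub_t_sq : IsUnit (1 - t ^ 2) := by
  rw [show 1 - t ^ 2 = (1 - t) * (1 + t) by ring]
  exact isUnit_one_sub_t.mul isUnit_one_add_t

theorem one_sub_t_mul_z : (1 - t) * z = (1 + t) * x := by
  rw [z, mul_comm, mul_assoc, Ring.inverse_mul_cancel _ isUnit_one_sub_t, mul_one]

theorem one_add_t_sq_mul_u : (1 + t) ^ 2 * u = 4 * t := by
  rw [u, mul_comm, mul_assoc, Ring.inverse_mul_cancel _ (isUnit_one_add_t.pow 2), mul_one]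

theorem constantCoeff_constantCoeff_z :
    PowerSeries.constantCoeff (PowerSeries.constantCoeff z) = 0 := by
  simp [z, x, x₀]

theorem chainSubst_one : chainSubst 1 = Ring.inverse (1 - t) := by
  apply isUnit_one_sub_t.mul_right_cancel
  rw [Ring.inverse_mul_cancel _ isUnit_one_sub_t]
  refine Eq.trans (congrArg (· * (1 - t)) ?_) (PowerSeries.mk_one_mul_one_sub_eq_one SX)
  ext k l : 2
  rw [coeff_coeff_chainSubst, PowerSeries.coeff_mk, Pi.one_apply, PowerSeries.coeff_one]
  split_ifs with h
  · simp [h, enrichedCard_zero]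
  · simp

theorem chainSubst_X : chainSubst PowerSeries.X = 2 * t * x * Ring.inverse ((1 - t) ^ 2) := by
  have h1 : chainSubst PowerSeries.X = x * enrichedSeries SX (fun _ => True) 0 := by
    ext k l : 2
    rw [coeff_coeff_chainSubst, x, PowerSeries.coeff_C_mul, enrichedSeries, PowerSeries.coeff_mk,
      x₀, PowerSeries.coeff_X, ← map_natCast PowerSeries.C, PowerSeries.coeff_mul_C,
      PowerSeries.coeff_X]
    split_ifs with h
    · simp [h]
    · simp
  have h2 : IsUnit (2 : SX) := by
    have := isUnit_two.map PowerSeries.constantCoeff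
    rwa [map_ofNat] at this
  have h3 := one_sub_X_pow_mul_enrichedSeries_true h2 0
  apply (isUnit_one_sub_t.pow 2).mul_right_cancel
  rw [mul_assoc (2 * t * x), Ring.inverse_mul_cancel _ (isUnit_one_sub_t.pow 2), h1]
  change (1 - t) ^ (0 + 2) * _ = 2 * t * (1 + t) ^ 0 at h3
  linear_combination x * h3

/-- One more letter multiplies the series of ascending words by `(1+t)/(1-t)`, but only for nonempty
words. The factor `X` in front of `χ` excludes the empty one. -/
theorem chainSubst_X_mul_X_mul (χ : SX) :
    chainSubst (PowerSeries.X * (PowerSeries.X * χ)) = z * chainSubst (PowerSeries.X * χ) := by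
  have key : ∀ n k, (enrichedCard (fun _ => True) (n + 2) (2 * (k + 1)) : ℚ[X]) -
      enrichedCard (fun _ => True) (n + 2) (2 * k) =
      enrichedCard (fun _ => True) (n + 1) (2 * (k + 1)) +
        enrichedCard (fun _ => True) (n + 1) (2 * k) := by
    intro n k
    have h := congrArg (PowerSeries.coeff (k + 1))
      (one_sub_X_mul_enrichedSeries_succ ℚ[X] (fun _ => True) (n := n) trivial)
    simpa [sub_mul, add_mul, PowerSeries.coeff_succ_X_mul, enrichedSeries] using h
  apply isUnit_one_sub_t.mul_left_cancel
  rw [← mul_assoc (1 - t) z, one_sub_t_mul_z, show (1 + t) * x * chainSubst (PowerSeries.X * χ) =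
    x * ((1 + t) * chainSubst (PowerSeries.X * χ)) by ring, sub_mul, add_mul, one_mul, one_mul]
  ext k l : 2
  rw [x, PowerSeries.coeff_C_mul, map_sub, map_add, map_sub, x₀, t]
  have hk0 : ∀ n, (enrichedCard (fun _ => True) (n + 1) 0) = 0 := by simp [enrichedCard_succ]
  rcases l with _ | _ | l
  · rw [PowerSeries.coeff_zero_X_mul]
    rcases k with _ | k
    · rw [PowerSeries.coeff_zero_X_mul]
      simp [coeff_coeff_chainSubst, PowerSeries.coeff_zero_X_mul,
        -PowerSeries.coeff_zero_eq_constantCoeff]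
    · rw [PowerSeries.coeff_succ_X_mul]
      simp [coeff_coeff_chainSubst, PowerSeries.coeff_zero_X_mul,
        -PowerSeries.coeff_zero_eq_constantCoeff]
  · rw [PowerSeries.coeff_succ_X_mul, map_add]
    rcases k with _ | k
    · rw [PowerSeries.coeff_zero_X_mul]
      simp [coeff_coeff_chainSubst, PowerSeries.coeff_succ_X_mul,
        PowerSeries.coeff_zero_X_mul,
        -PowerSeries.coeff_zero_eq_constantCoeff]
    · rw [PowerSeries.coeff_succ_X_mul, PowerSeries.coeff_succ_X_mul]
      simp [coeff_coeff_chainSubst, PowerSeries.coeff_succ_X_mul,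
        PowerSeries.coeff_zero_X_mul,
        -PowerSeries.coeff_zero_eq_constantCoeff]
  · rw [PowerSeries.coeff_succ_X_mul, map_add]
    rcases k with _ | k
    · rw [PowerSeries.coeff_zero_X_mul, PowerSeries.coeff_zero_X_mul]
      simp [coeff_coeff_chainSubst, hk0, -PowerSeries.coeff_zero_eq_constantCoeff]
    · rw [PowerSeries.coeff_succ_X_mul, PowerSeries.coeff_succ_X_mul]
      simp only [coeff_coeff_chainSubst, PowerSeries.coeff_succ_X_mul]
      linear_combination PowerSeries.coeff l χ * key l k

theorem chainSubst_X_mul_X_pow_mul (n : ℕ) (χ : SX) :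
    chainSubst (PowerSeries.X * (PowerSeries.X ^ n * χ)) =
      z ^ n * chainSubst (PowerSeries.X * χ) := by
  induction n with
  | zero => simp
  | succ n ih =>
    rw [pow_succ', mul_assoc, chainSubst_X_mul_X_mul, ih, pow_succ']
    ring

end Substitution

/-! ### The left-hand side as a series of words -/

section GeneratingFunction

theorem z_eq : z = (1 + t) * Ring.inverse (1 - t) * x := by
  rw [z]
  ring

theorem summable_ipkPoly (m : ℕ) (a : SXT) :
    Summable fun n : ℕ => ipkPoly (mono m) (n + 1) a u * z ^ (n + 1) := by
  rw [PowerSeries.WithPiTopology.summable_iff_summable_coeff]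
  intro k
  rw [PowerSeries.WithPiTopology.summable_iff_summable_coeff]
  intro l
  refine summable_of_ne_finset_zero (s := Finset.range l) fun n hn => ?_
  -- Since `z` is a multiple of `x`, the summand is divisible by `x^(n+1)`, and only those with `n <
  -- l` reach degree `l`.
  have hz : ipkPoly (mono m) (n + 1) a u * z ^ (n + 1) = PowerSeries.C (x₀ ^ (n + 1)) *
      (ipkPoly (mono m) (n + 1) a u * ((1 + t) * Ring.inverse (1 - t)) ^ (n + 1)) := by
    rw [z_eq, mul_pow, x, map_pow]
    ring
  rw [hz, PowerSeries.coeff_C_mul, x₀, PowerSeries.coeff_X_pow_mul', if_neg]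
  rw [Finset.mem_range] at hn
  omega

theorem coeff_genFun_summand (m n k : ℕ) (a : ℚ[X]) :
    PowerSeries.coeff k ((1 + t) * Ring.inverse (2 * (1 - t)) *
      (ipkPoly (mono m) (n + 1) (PowerSeries.C (PowerSeries.C a)) u * z ^ (n + 1))) =
      PowerSeries.C (wordSum m a (2 * k) (n + 1)) * PowerSeries.X ^ (n + 1) := by
  have h1 : ∀ π : Equiv.Perm (Fin (n + 1)), (1 + t) * Ring.inverse (2 * (1 - t)) *
      (u ^ (ipk π + 1) * z ^ (n + 1)) =
      x ^ (n + 1) * enrichedSeries SX (PermAsc π⁻¹) n := by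
    intro π
    have hA : (1 - t) * ((1 + t) * Ring.inverse (1 - t)) = 1 + t := by
      rw [mul_left_comm, Ring.mul_inverse_cancel _ isUnit_one_sub_t, mul_one]
    have h := two_mul_enrichedSeries (P := PermAsc π⁻¹) hA one_add_t_sq_mul_u isUnit_one_sub_t
      isUnit_one_add_t n
    rw [peakCount_eq_pk] at h
    apply (isUnit_two.mul isUnit_one_sub_t).mul_left_cancel
    have h2 : (2 * (1 - t)) * Ring.inverse (2 * (1 - t)) = 1 :=
      Ring.mul_inverse_cancel _ (isUnit_two.mul isUnit_one_sub_t)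
    calc _ = ((2 * (1 - t)) * Ring.inverse (2 * (1 - t))) * (1 + t) *
          (u ^ (ipk π + 1) * z ^ (n + 1)) := by ring
      _ = (1 - t) * x ^ (n + 1) * (2 * enrichedSeries SX (PermAsc π⁻¹) n) := by
          rw [h, h2, one_mul, ipk, z_eq]
          generalize (1 + t) * Ring.inverse (1 - t) = A at hA
          rw [← hA]
          ring
      _ = _ := by ring
  have h2 : (1 + t) * Ring.inverse (2 * (1 - t)) *
      (ipkPoly (mono m) (n + 1) (PowerSeries.C (PowerSeries.C a)) u * z ^ (n + 1)) =
      ∑ π : Equiv.Perm (Fin (n + 1)), PowerSeries.C (PowerSeries.C (a ^ occ (mono m) π)) *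
        (PowerSeries.C (x₀ ^ (n + 1)) * enrichedSeries SX (PermAsc π⁻¹) n) := by
    rw [ipkPoly, if_neg (by omega), Finset.sum_mul, Finset.mul_sum]
    refine Finset.sum_congr rfl fun π _ => ?_
    rw [map_pow PowerSeries.C x₀]
    change _ = _ * (x ^ (n + 1) * _)
    rw [← h1, map_pow, map_pow]
    ring
  rw [h2, map_sum, wordSum_eq_sum_perm, map_sum, Finset.sum_mul]
  refine Finset.sum_congr rfl fun π _ => ?_
  rw [PowerSeries.coeff_C_mul, PowerSeries.coeff_C_mul, enrichedSeries, PowerSeries.coeff_mk,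
    x₀, map_mul, map_natCast]
  ring

/-- The summands with `n ≥ 1` give the nonempty words, and `1/(1-t)` gives the empty word for every
`k`. -/
theorem coeff_genFun (m k : ℕ) (hm : 2 ≤ m) (a : ℚ[X]) :
    PowerSeries.coeff k (genFun m (PowerSeries.C (PowerSeries.C a))) =
      PowerSeries.mk (wordSum m a (2 * k)) := by
  have hs := (summable_ipkPoly m (PowerSeries.C (PowerSeries.C a))).hasSum.mul_left
    ((1 + t) * Ring.inverse (2 * (1 - t)))
  have hk := (PowerSeries.WithPiTopology.hasSum_iff_hasSum_coeff _).1 hs k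
  simp only [coeff_genFun_summand] at hk
  have hu := hk.unique (hasSum_C_mul_X_pow_succ fun n => wordSum m a (2 * k) (n + 1))
  rw [genFun, map_add, hu, ← chainSubst_one]
  ext l : 1
  rw [map_add, coeff_coeff_chainSubst, PowerSeries.coeff_mk]
  rcases l with _ | l
  · simp [wordSum_zero hm, enrichedCard_zero]
  · rw [PowerSeries.coeff_succ_X_mul, PowerSeries.coeff_mk, PowerSeries.coeff_one,
      if_neg (by omega), zero_mul, zero_add]

end GeneratingFunction

/-! ### Hadamard powers as coefficientwise geometric series -/

section Hadamard

theorem coeff_hadamardPow {B : Type*} [CommRing B] (f : B⟦X⟧) (n k : ℕ) :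
    PowerSeries.coeff k (hadamardPow f n) = PowerSeries.coeff k f ^ n := by
  induction n with
  | zero => simp [hadamardPow]
  | succ n ih => rw [hadamardPow, hadamard, PowerSeries.coeff_mk, ih, pow_succ]

theorem summable_hadamardPow {f : SXT}
    (hf : ∀ k, PowerSeries.constantCoeff (PowerSeries.coeff k f) = 0) :
    Summable fun n => hadamardPow f n := by
  rw [PowerSeries.WithPiTopology.summable_iff_summable_coeff]
  intro k
  simp only [coeff_hadamardPow]
  exact PowerSeries.WithPiTopology.summable_pow_of_constantCoeff_eq_zero (hf k)

theorem coeff_tsum_hadamardPow_mul {f : SXT}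
    (hf : ∀ k, PowerSeries.constantCoeff (PowerSeries.coeff k f) = 0) (k : ℕ) :
    PowerSeries.coeff k (∑' n, hadamardPow f n) * (1 - PowerSeries.coeff k f) = 1 := by
  have h := (PowerSeries.WithPiTopology.hasSum_iff_hasSum_coeff _).1 (summable_hadamardPow hf).hasSum k
  simp only [coeff_hadamardPow] at h
  rw [← h.tsum_eq]
  exact PowerSeries.WithPiTopology.tsum_pow_mul_one_sub_of_constantCoeff_eq_zero (hf k)

end Hadamard

/-! ### Identities (a) and (b) -/

section Terms

/-- The common generalization of `termA` and `termB`, which are the cases `a = s` and `a = 0`. -/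
noncomputable def termOf (m : ℕ) (a : SXT) : SXT :=
  2 * t * x * Ring.inverse ((1 - t) ^ 2) +
    2 * t * (a - 1) * z ^ m *
      Ring.inverse ((1 - t ^ 2) * (1 - (a - 1) * ∑ l ∈ Finset.Icc 1 (m - 1), z ^ l))

theorem one_sub_mul_sum_Icc {R : Type*} [CommRing R] (y : R) {m : ℕ} (hm : 1 ≤ m) :
    (1 - y) * ∑ l ∈ Finset.Icc 1 (m - 1), y ^ l = y - y ^ m := by
  rw [← Finset.Ico_add_one_right_eq_Icc, Nat.sub_add_cancel hm]
  have := mul_neg_geom_sum y m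
  have h2 : ∑ l ∈ Finset.Ico 1 m, y ^ l = ∑ l ∈ Finset.range m, y ^ l - 1 := by
    rw [Finset.sum_Ico_eq_sub _ hm]
    simp
  rw [h2, mul_sub, this]
  ring

theorem constantCoeff_constantCoeff_sum_z (m : ℕ) :
    PowerSeries.constantCoeff (PowerSeries.constantCoeff
      (∑ l ∈ Finset.Icc 1 (m - 1), z ^ l)) = 0 := by
  rw [map_sum, map_sum]
  refine Finset.sum_eq_zero fun l hl => ?_
  rw [map_pow, map_pow, constantCoeff_constantCoeff_z,
    zero_pow (by have := Finset.mem_Icc.1 hl; omega)]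

theorem isUnit_one_sub_mul_sum_z (m : ℕ) (a : SXT) :
    IsUnit (1 - (a - 1) * ∑ l ∈ Finset.Icc 1 (m - 1), z ^ l) := by
  rw [isUnit_iff_isUnit_constantCoeff, map_sub, map_sub, map_mul, map_mul,
    constantCoeff_constantCoeff_sum_z, mul_zero, map_one, map_one, sub_zero]
  exact isUnit_one

theorem isUnit_one_sub_z_pow {m : ℕ} (hm : m ≠ 0) : IsUnit (1 - z ^ m) := by
  rw [isUnit_iff_isUnit_constantCoeff, map_sub, map_sub, map_pow, map_pow,
    constantCoeff_constantCoeff_z, zero_pow hm, map_one, map_one, sub_zero]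
  exact isUnit_one

theorem two_t_x_mul_one_sub_t_sq :
    2 * t * x * Ring.inverse ((1 - t) ^ 2) * (1 - t ^ 2) = 2 * t * z := by
  apply (isUnit_one_sub_t.pow 2).mul_left_cancel
  calc _ = 2 * t * x * (Ring.inverse ((1 - t) ^ 2) * (1 - t) ^ 2) * (1 - t ^ 2) := by ring
    _ = 2 * t * ((1 - t) * ((1 + t) * x)) := by
      rw [Ring.inverse_mul_cancel _ (isUnit_one_sub_t.pow 2)]
      ring
    _ = _ := by
      rw [← one_sub_t_mul_z]
      ring

/-- For `a = 0` the inner denominator is `1 + z + ⋯ + z^(m-1) = (1-z^m)/(1-z)`, and `z -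
z^m(1-z)/(1-z^m) = z(1-z^(m-1))/(1-z^m)`. -/
theorem termB_eq_termOf {m : ℕ} (hm : 1 ≤ m) : termB m = termOf m 0 := by
  have hU := isUnit_one_sub_mul_sum_z m 0
  have h1 := isUnit_one_sub_z_pow (m := m) (by omega)
  have hz := one_sub_mul_sum_Icc z hm
  have hψ : (1 - z) * (1 - (0 - 1) * ∑ l ∈ Finset.Icc 1 (m - 1), z ^ l) = 1 - z ^ m := by
    linear_combination hz
  apply (isUnit_one_sub_t_sq.mul h1).mul_right_cancel
  rw [termB, mul_assoc (2 * t * z * (1 - z ^ (m - 1))),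
    Ring.inverse_mul_cancel _ (isUnit_one_sub_t_sq.mul h1), termOf]
  have hi := Ring.inverse_mul_cancel _ (isUnit_one_sub_t_sq.mul hU)
  have h2 := two_t_x_mul_one_sub_t_sq
  have hp : z * z ^ (m - 1) = z ^ m := by rw [← pow_succ', Nat.sub_add_cancel hm]
  linear_combination (-(1 - z ^ m)) * h2 - 2 * t * hp + 2 * t * z ^ m * (1 - z) * hi +
    2 * t * z ^ m * (1 - t ^ 2) * Ring.inverse ((1 - t ^ 2) *
      (1 - (0 - 1) * ∑ l ∈ Finset.Icc 1 (m - 1), z ^ l)) * -hψ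

/-- The reciprocal `(1 - a y)/ψ` is rewritten as `1 - y - y φ` with `φ = (a-1) y^(m-1)/ψ`. The three
terms map to `1/(1-t)` and the two summands of `termOf`; the factor `y` before `φ` lets
multiplication by `ψ` pass to multiplication by its value at `z`. -/
theorem exists_runSeries_inverse {m : ℕ} (hm : 2 ≤ m) (a : ℚ[X]) :
    ∃ V : SX, V * runSeries m a = 1 ∧
      chainSubst V = Ring.inverse (1 - t) - termOf m (PowerSeries.C (PowerSeries.C a)) := by
  set ψ : SX := 1 - (PowerSeries.C a - 1) * ∑ l ∈ Finset.Icc 1 (m - 1), PowerSeries.X ^ l with hψ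
  have hU : IsUnit ψ := by
    rw [PowerSeries.isUnit_iff_constantCoeff, hψ, map_sub, map_mul, map_sum, Finset.sum_eq_zero]
    · simp
    · intro l hl
      rw [map_pow, PowerSeries.constantCoeff_X,
        zero_pow (by have := Finset.mem_Icc.1 hl; omega)]
  obtain ⟨φ, hφ⟩ : ψ ∣ (PowerSeries.C a - 1) * PowerSeries.X ^ (m - 1) := hU.dvd
  have hs := one_sub_mul_sum_Icc (PowerSeries.X : SX) (m := m) (by omega)
  have hp : (PowerSeries.X : SX) * PowerSeries.X ^ (m - 1) = PowerSeries.X ^ m := by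
    rw [← pow_succ', Nat.sub_add_cancel (by omega)]
  refine ⟨1 - PowerSeries.X - PowerSeries.X * φ, ?_, ?_⟩
  · have hW := runSeries_mul m hm a
    rw [← hψ] at hW
    apply hU.mul_left_cancel
    have e : ψ * (1 - PowerSeries.X - PowerSeries.X * φ) = 1 - PowerSeries.C a * PowerSeries.X := by
      rw [show ψ * (1 - PowerSeries.X - PowerSeries.X * φ) =
        (1 - PowerSeries.X) * ψ - PowerSeries.X * (ψ * φ) by ring, ← hφ, hψ]
      linear_combination (-(PowerSeries.C a - 1)) * hs - (PowerSeries.C a - 1) * hp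
    rw [← mul_assoc, e, mul_comm, hW, mul_one]
  · rw [map_sub, map_sub, chainSubst_one, sub_sub]
    congr 1
    rw [termOf, chainSubst_X]
    congr 1
    have hz := isUnit_one_sub_mul_sum_z m (PowerSeries.C (PowerSeries.C a))
    apply (isUnit_one_sub_t_sq.mul hz).mul_right_cancel
    rw [mul_assoc _ (Ring.inverse _), Ring.inverse_mul_cancel _ (isUnit_one_sub_t_sq.mul hz)]
    have h1 : chainSubst (PowerSeries.X * (ψ * φ)) =
        (1 - (PowerSeries.C (PowerSeries.C a) - 1) * ∑ l ∈ Finset.Icc 1 (m - 1), z ^ l) *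
          chainSubst (PowerSeries.X * φ) := by
      have e : PowerSeries.X * (ψ * φ) = PowerSeries.X * φ -
          PowerSeries.C (a - 1) *
            ∑ l ∈ Finset.Icc 1 (m - 1), PowerSeries.X * (PowerSeries.X ^ l * φ) := by
        rw [← Finset.mul_sum, ← Finset.sum_mul, hψ, map_sub, map_one]
        ring
      rw [e, map_sub, chainSubst_C_mul, map_sum,
        Finset.sum_congr rfl fun l _ => chainSubst_X_mul_X_pow_mul l φ, ← Finset.sum_mul]
      simp only [map_sub, map_one]
      ring
    have h2 : chainSubst (PowerSeries.X * (ψ * φ)) =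
        (PowerSeries.C (PowerSeries.C a) - 1) * z ^ (m - 1) * chainSubst PowerSeries.X := by
      rw [← hφ, show (PowerSeries.X : SX) * ((PowerSeries.C a - 1) * PowerSeries.X ^ (m - 1)) =
        PowerSeries.C (a - 1) * (PowerSeries.X * (PowerSeries.X ^ (m - 1) * 1)) by
          rw [map_sub, map_one]; ring, chainSubst_C_mul, chainSubst_X_mul_X_pow_mul, mul_one]
      simp only [map_sub, map_one]
      ring
    have hpz : z * z ^ (m - 1) = z ^ m := by rw [← pow_succ', Nat.sub_add_cancel (by omega)]
    rw [h1, chainSubst_X] at h2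
    linear_combination (1 - t ^ 2) * h2 + (PowerSeries.C (PowerSeries.C a) - 1) * z ^ (m - 1) *
      two_t_x_mul_one_sub_t_sq + 2 * t * (PowerSeries.C (PowerSeries.C a) - 1) * hpz

theorem coeff_termOf_of_chainSubst {m : ℕ} {a : ℚ[X]} {V : SX}
    (hV : chainSubst V = Ring.inverse (1 - t) - termOf m (PowerSeries.C (PowerSeries.C a)))
    (k : ℕ) : PowerSeries.coeff k (termOf m (PowerSeries.C (PowerSeries.C a))) =
      1 - PowerSeries.coeff k (chainSubst V) := by
  have h1 : PowerSeries.coeff k (Ring.inverse (1 - t)) = 1 := by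
    rw [← chainSubst_one]
    ext l : 1
    rw [coeff_coeff_chainSubst, PowerSeries.coeff_one]
    split_ifs with h
    · simp [h, enrichedCard_zero]
    · simp
  rw [hV, map_sub, h1]
  ring

theorem constantCoeff_coeff_termOf {m : ℕ} (hm : 2 ≤ m) (a : ℚ[X]) (k : ℕ) :
    PowerSeries.constantCoeff
      (PowerSeries.coeff k (termOf m (PowerSeries.C (PowerSeries.C a)))) = 0 := by
  obtain ⟨V, hV, hV'⟩ := exists_runSeries_inverse hm a
  have h0 := congrArg PowerSeries.constantCoeff hV
  simp only [runSeries, map_mul, ← PowerSeries.coeff_zero_eq_constantCoeff_apply,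
    PowerSeries.coeff_mk, map_one] at h0
  rw [show 0 + 1 - m = 0 by omega, pow_zero, mul_one] at h0
  rw [coeff_termOf_of_chainSubst hV', ← PowerSeries.coeff_zero_eq_constantCoeff_apply, map_sub,
    coeff_coeff_chainSubst, h0, enrichedCard_zero]
  simp

theorem chainSubst_mul_coeff_genFun {m : ℕ} (hm : 2 ≤ m) {a : ℚ[X]} {V : SX}
    (hV : V * runSeries m a = 1) (k : ℕ) :
    PowerSeries.coeff k (chainSubst V) *
      PowerSeries.coeff k (genFun m (PowerSeries.C (PowerSeries.C a))) = 1 := by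
  rw [coeff_genFun m k hm a, ← mk_wordSum_mul_eq_one hm hV (2 * k)]
  congr 1
  ext l : 1
  rw [coeff_coeff_chainSubst, PowerSeries.coeff_mk]

/-- In each degree `k` both sides are inverse to the coefficient of `chainSubst V`. -/
theorem genFun_eq_tsum_hadamardPow {m : ℕ} (hm : 2 ≤ m) (a : ℚ[X]) :
    genFun m (PowerSeries.C (PowerSeries.C a)) =
      ∑' n, hadamardPow (termOf m (PowerSeries.C (PowerSeries.C a))) n := by
  obtain ⟨V, hV, hV'⟩ := exists_runSeries_inverse hm a
  ext k : 1
  have h1 := coeff_tsum_hadamardPow_mul (constantCoeff_coeff_termOf hm a) k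
  rw [coeff_termOf_of_chainSubst hV', sub_sub_cancel] at h1
  exact (left_inv_eq_right_inv h1 (chainSubst_mul_coeff_genFun hm hV k)).symm

end Terms

/-! ### Identity (c) -/

section Explicit

theorem c_eq_enrichedCard {m j : ℕ} (hm : 1 ≤ m) (hj : 1 ≤ j) (k : ℕ) :
    c m j k = enrichedCard (fun _ => True) (j * m) (2 * k) := by
  have h : 1 ≤ j * m := Nat.mul_pos hj hm
  conv_rhs => rw [← Nat.sub_add_cancel h]
  rw [enrichedCard_true_succ, c]
  congr 1
  refine Finset.sum_congr rfl fun l _ => ?_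
  rw [Nat.add_sub_assoc h]

theorem c'_eq_enrichedCard (m j k : ℕ) :
    c' m j k = enrichedCard (fun _ => True) (j * m + 1) (2 * k) := by
  rw [enrichedCard_true_succ, c']

/-- The reciprocal `(1 - y) / (1 - y ^ m)` of `runSeries m 0`. -/
noncomputable def runInverse (m : ℕ) : SX :=
  PowerSeries.mk fun l => (if l % m = 0 then 1 else 0) - if l % m = 1 then 1 else 0

theorem runInverse_mul {m : ℕ} (hm : 2 ≤ m) : runInverse m * runSeries m 0 = 1 := by
  -- The coefficients are periodic modulo `m`, so only degrees below `m` survive.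
  have h1 : runInverse m * (1 - PowerSeries.X ^ m) = 1 - PowerSeries.X := by
    ext l : 1
    rw [mul_sub, mul_one, map_sub, PowerSeries.coeff_mul_X_pow', map_sub, PowerSeries.coeff_one,
      PowerSeries.coeff_X]
    simp only [runInverse, PowerSeries.coeff_mk]
    by_cases h : m ≤ l
    · rw [if_pos h, ← Nat.mod_eq_sub_mod h, if_neg (show ¬ l = 0 by omega),
        if_neg (show ¬ l = 1 by omega)]
      ring
    · rw [if_neg h, Nat.mod_eq_of_lt (by omega), sub_zero]
  have h2 := runSeries_mul m hm (0 : ℚ[X])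
  have h3 := one_sub_mul_sum_Icc (PowerSeries.X : SX) (m := m) (by omega)
  rw [map_zero, zero_mul, sub_zero, mul_one] at h2
  have hU : IsUnit (1 - PowerSeries.X : SX) := isUnit_one_sub_X _
  apply hU.mul_left_cancel
  rw [h2, mul_one]
  linear_combination runInverse m * h3 + h1

theorem hasSum_summandC {m : ℕ} (hm : 2 ≤ m) (k : ℕ) :
    HasSum (fun j => summandC m k (j + 1))
      (PowerSeries.coeff k (chainSubst (runInverse m)) - (1 - 2 * (k : SX) * x₀)) := by
  rw [PowerSeries.WithPiTopology.hasSum_iff_hasSum_coeff]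
  intro l
  have hc : ∀ j, PowerSeries.coeff l (summandC m k (j + 1)) =
      (if l = (j + 1) * m then (enrichedCard (fun _ => True) l (2 * k) : ℚ[X]) else 0) -
      if l = (j + 1) * m + 1 then (enrichedCard (fun _ => True) l (2 * k) : ℚ[X]) else 0 := by
    intro j
    rw [summandC, c_eq_enrichedCard (by omega) (by omega), c'_eq_enrichedCard, map_sub, x₀,
      ← map_natCast PowerSeries.C, ← map_natCast PowerSeries.C, PowerSeries.coeff_C_mul,
      PowerSeries.coeff_C_mul, PowerSeries.coeff_X_pow, PowerSeries.coeff_X_pow]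
    split_ifs with h1 h2 h2 <;> simp_all
  -- This is the missing term `j = 0`: there is one empty word and there are `2k` words of one
  -- letter.
  have hd : PowerSeries.coeff l (1 - 2 * (k : SX) * x₀) =
      (if l = 0 then (enrichedCard (fun _ => True) l (2 * k) : ℚ[X]) else 0) -
      if l = 1 then (enrichedCard (fun _ => True) l (2 * k) : ℚ[X]) else 0 := by
    rw [map_sub, PowerSeries.coeff_one, x₀, show (2 : SX) * (k : SX) = PowerSeries.C (2 * (k : ℚ[X])) by
      rw [map_mul, map_natCast, map_ofNat],
      PowerSeries.coeff_C_mul, PowerSeries.coeff_X]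
    split_ifs with h1 h2 h2
    · omega
    · simp [h1, enrichedCard_zero]
    · simp [h2, enrichedCard_succ, enrichedCount]
    · simp
  -- Only the summand with `j + 1 = l / m` can reach degree `l`. For `l < m` the index truncates to
  -- `0`, whose summand begins in degree `m` and contributes nothing.
  have hval : PowerSeries.coeff l
      (PowerSeries.coeff k (chainSubst (runInverse m)) - (1 - 2 * (k : SX) * x₀)) =
      PowerSeries.coeff l (summandC m k (l / m - 1 + 1)) := by
    rw [map_sub, coeff_coeff_chainSubst, hd, hc, runInverse, PowerSeries.coeff_mk]
    have hl := Nat.div_add_mod l m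
    have hlt := Nat.mod_lt l (show m > 0 by omega)
    rcases Nat.eq_zero_or_pos (l / m) with h | h
    · rw [h] at hl ⊢
      have h0 : l % m = l := by omega
      rw [h0, if_neg (show ¬ l = (0 - 1 + 1) * m by omega),
        if_neg (show ¬ l = (0 - 1 + 1) * m + 1 by omega)]
      split_ifs <;> simp
    · have hml : m * 1 ≤ m * (l / m) := Nat.mul_le_mul_left m h
      rw [Nat.sub_add_cancel h, mul_comm (l / m) m, if_neg (show ¬ l = 0 by omega),
        if_neg (show ¬ l = 1 by omega), sub_zero, sub_zero,
        if_congr (show l = m * (l / m) ↔ l % m = 0 by omega) rfl rfl,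
        if_congr (show l = m * (l / m) + 1 ↔ l % m = 1 by omega) rfl rfl]
      split_ifs <;> simp
  rw [hval]
  refine hasSum_single _ fun j hj => ?_
  rw [hc, if_neg, if_neg, sub_zero]
  · rintro rfl
    apply hj
    rw [mul_comm, Nat.mul_add_div (by omega), Nat.div_eq_of_lt (by omega)]
    omega
  · rintro rfl
    apply hj
    rw [Nat.mul_div_cancel _ (by omega)]
    omega

theorem denomC_eq {m : ℕ} (hm : 2 ≤ m) (k : ℕ) :
    denomC m k = PowerSeries.coeff k (chainSubst (runInverse m)) := by
  rw [denomC, (hasSum_summandC hm k).tsum_eq]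
  ring

theorem denomC_mul_coeff_genFun {m : ℕ} (hm : 2 ≤ m) (k : ℕ) :
    denomC m k * PowerSeries.coeff k (genFun m 0) = 1 := by
  have := chainSubst_mul_coeff_genFun hm (runInverse_mul hm) k
  rwa [map_zero, map_zero, ← denomC_eq hm] at this

theorem genFun_zero_eq_tsum_denomC {m : ℕ} (hm : 2 ≤ m) :
    genFun m 0 =
      1 + ∑' k : ℕ, PowerSeries.C (Ring.inverse (denomC m (k + 1))) * t ^ (k + 1) := by
  have h := (hasSum_C_mul_X_pow_succ fun k => Ring.inverse (denomC m (k + 1))).tsum_eq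
  rw [show (fun k => PowerSeries.C (Ring.inverse (denomC m (k + 1))) * t ^ (k + 1)) =
    fun k => PowerSeries.C (Ring.inverse (denomC m (k + 1))) * PowerSeries.X ^ (k + 1) from rfl, h]
  ext k : 1
  rw [map_add, PowerSeries.coeff_one]
  rcases k with _ | k
  -- For `k = 0` the alphabet is empty and only the empty word remains, which is the separate
  -- summand `1`.
  · rw [PowerSeries.coeff_zero_X_mul, if_pos rfl, add_zero]
    have h0 := coeff_genFun m 0 hm 0
    rw [map_zero, map_zero] at h0
    rw [h0]
    ext l : 1
    rw [PowerSeries.coeff_mk, PowerSeries.coeff_one]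
    split_ifs with hl
    · rw [hl, wordSum_zero hm]
    · have : Nonempty (Fin l) := ⟨⟨0, by omega⟩⟩
      have : IsEmpty (Fin l → Fin (2 * 0)) := ⟨fun f => (f (Classical.arbitrary _)).elim0⟩
      exact Finset.sum_of_isEmpty _
  · rw [PowerSeries.coeff_succ_X_mul, PowerSeries.coeff_mk, if_neg (by omega), zero_add]
    have h1 := denomC_mul_coeff_genFun hm (k + 1)
    have hU : IsUnit (denomC m (k + 1)) := IsUnit.of_mul_eq_one _ h1
    exact hU.mul_left_cancel (by rw [h1, Ring.mul_inverse_cancel _ hU])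

end Explicit

end MonotoneIpk

open MonotoneIpk in
theorem theorem4p5 (m : ℕ) (hm : 2 ≤ m) :
    -- all denominators are invertible
    (IsUnit (1 - t) ∧ IsUnit (1 + t) ∧ IsUnit (2 * (1 - t)) ∧
      IsUnit ((1 - t ^ 2) * (1 - (s - 1) * ∑ l ∈ Finset.Icc 1 (m - 1), z ^ l)) ∧
      IsUnit ((1 - t ^ 2) * (1 - z ^ m)) ∧
      ∀ k : ℕ, 1 ≤ k → IsUnit (denomC m k)) ∧
    -- all infinite sums converge formally
    (Summable (fun n : ℕ => ipkPoly (mono m) (n + 1) s u * z ^ (n + 1)) ∧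
      Summable (fun n : ℕ => ipkPoly (mono m) (n + 1) 0 u * z ^ (n + 1)) ∧
      Summable (fun n : ℕ => hadamardPow (termA m) n) ∧
      Summable (fun n : ℕ => hadamardPow (termB m) n) ∧
      (∀ k : ℕ, 1 ≤ k → Summable (fun j : ℕ => summandC m k (j + 1))) ∧
      Summable (fun k : ℕ =>
        (PowerSeries.C (Ring.inverse (denomC m (k + 1))) * t ^ (k + 1) : SXT))) ∧
    -- (a)
    genFun m s = ∑' n : ℕ, hadamardPow (termA m) n ∧
    -- (b)
    genFun m 0 = ∑' n : ℕ, hadamardPow (termB m) n ∧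
    -- (c)
    genFun m 0 =
      1 + ∑' k : ℕ, PowerSeries.C (Ring.inverse (denomC m (k + 1))) * t ^ (k + 1) := by
  have hA : termA m = termOf m (PowerSeries.C (PowerSeries.C Polynomial.X)) := rfl
  have h0 : (0 : SXT) = PowerSeries.C (PowerSeries.C 0) := by rw [map_zero, map_zero]
  have hB : termB m = termOf m (PowerSeries.C (PowerSeries.C 0)) := by
    rw [termB_eq_termOf (by omega), h0]
  refine ⟨⟨isUnit_one_sub_t, isUnit_one_add_t, isUnit_two.mul isUnit_one_sub_t,
    isUnit_one_sub_t_sq.mul (isUnit_one_sub_mul_sum_z m s),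
    isUnit_one_sub_t_sq.mul (isUnit_one_sub_z_pow (by omega)),
    fun k _ => IsUnit.of_mul_eq_one _ (denomC_mul_coeff_genFun hm k)⟩,
    ⟨summable_ipkPoly m s, summable_ipkPoly m 0, ?_, ?_,
      fun k _ => (hasSum_summandC hm k).summable, (hasSum_C_mul_X_pow_succ _).summable⟩,
    ?_, ?_, genFun_zero_eq_tsum_denomC hm⟩
  · rw [hA]
    exact summable_hadamardPow (constantCoeff_coeff_termOf hm _)
  · rw [hB]
    exact summable_hadamardPow (constantCoeff_coeff_termOf hm _)
  · rw [hA]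
    exact genFun_eq_tsum_hadamardPow hm _
  · rw [hB, h0]
    exact genFun_eq_tsum_hadamardPow hm _
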